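/- Let $\alpha,\beta,\gamma\in\mathbb R$ with $\alpha+\beta+\gamma=0$ and $\alpha\beta<0$, let $c>0$, and consider the perturbed Euler top $$\dot x_1=\alpha x_2x_3+\epsilon A,\qquad \dot x_2=\beta x_1x_3+\epsilon B,\qquad \dot x_3=\gamma x_1x_2+\epsilon C,$$ where $(A,B,C)$ is a polynomial vector field on $\mathbb R^3$, homogeneous of degree $m$ (that is, $A,B,C$ are homogeneous polynomials of degree $m$, possibly zero), with $x_1A+x_2B+x_3C=0$ and $A=x_3P(x_1,x_2,x_3^2)$, $B=x_3Q(x_1,x_2,x_3^2)$ for polynomials $P,Q$ in three variables. Let $H(x,y)=\frac12(\alpha y^2-\beta x^2)$ and, for $h$ with $\alpha h>0$, let $$I(h)=\oint_{H=h}P(x,y,c^2-x^2-y^2)\,dy-Q(x,y,c^2-x^2-y^2)\,dx$$ (the ellipse $H=h$ being traversed counterclockwise). For those $h$ for which the ellipse lies in $x^2+y^2<c^2$ this equals $$\oint_{H=h}\frac{A\,dy-B\,dx}{\sqrt{c^2-x^2-y^2}}$$ with $A,B$ taken at $(x,y,\sqrt{c^2-x^2-y^2})$, and $\gamma_h=\{x\in\mathbb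 S_c^+: H(x_1,x_2)=h\}$, where $\mathbb S_c^+=\{x_1^2+x_2^2+x_3^2=c^2,\ x_3>0\}$, is a periodic orbit of the system with $\epsilon=0$. A limit cycle is a periodic orbit that is the $\alpha$- or $\omega$-limit set of another orbit. We say that $N$ limit cycles bifurcate on $\mathbb S_c^+$ if there are $N$ families $\Gamma^i_\epsilon\subset\mathbb S_c^+$ of pairwise different limit cycles of the perturbed system, each tending in the Hausdorff distance, as $\epsilon\to0$ ($\epsilon\ne0$), to one of the periodic orbits $\gamma_{h}$ of the system with $\epsilon=0$. In the upper bounds below, the families need exist only along some sequence $\epsilon\to 0$ (or, more generally, along some filter). Then the following holds. If $m\ge3$, then $P$ and $Q$ have degree at most $n=m-1$, and if $I\not\equiv0$, then the number of limit cycles that bifurcate on $\mathbb S_c^+$ is strictly smaller than $n-1$. More precisely: (i) If $m=3$ or $m=5$, then $I(h)\equiv0$. (ii) Let $m=4$ and $k=1$, or $m=6$ and $k=2$. Then $I(h)=hM_k(h)$ with a polynomial $M_k$ of degree at most $k$. If $I\not\equiv0$, then at most $k$ limit cycles bifurcate on $\mathbb S_c^+$. This is the maximum: for all such $\alpha,\beta,\gamma,c$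 there is a perturbation field as above, with $I\not\equiv0$, for which $k$ limit cycles bifurcate on $\mathbb S_c^+$. (iii) If $m=7$ and $I\not\equiv0$, then $I$ has, among the $h$ with $\alpha h>0$, exactly one root if $\alpha\ne\beta$, namely $h^*=\alpha\beta c^2/(\beta-\alpha)$, which does not depend on $(A,B,C)$, and none if $\alpha=\beta$. -/

import Mathlib

open Filter Topology

noncomputable section

namespace EulerTop

/-- Phase space, with the Euclidean norm; the coordinates `x₁, x₂, x₃` are `x 0, x 1, x 2`. -/
abbrev Space : Type := EuclideanSpace ℝ (Fin 3)

/-- Real polynomials in three variables. -/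
abbrev Poly : Type := MvPolynomial (Fin 3) ℝ

/-- The value of a polynomial at the point `(x, y, z)`. -/
def val (F : Poly) (x y z : ℝ) : ℝ := MvPolynomial.eval ![x, y, z] F

/-- The perturbation field `(A, B, C)` is polynomial and homogeneous of degree `m`, it is tangent
to all the spheres centred at the origin, and
`A = x₃ P(x₁, x₂, x₃²)`, `B = x₃ Q(x₁, x₂, x₃²)` for the polynomials `P`, `Q`. -/
structure IsPerturbation (m : ℕ) (A B C P Q : Poly) : Prop where
  homA : A.IsHomogeneous m
  homB : B.IsHomogeneous m
  homC : C.IsHomogeneous m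
  tangent : MvPolynomial.X 0 * A + MvPolynomial.X 1 * B + MvPolynomial.X 2 * C = 0
  formA : A = MvPolynomial.X 2 *
    MvPolynomial.aeval ![MvPolynomial.X 0, MvPolynomial.X 1, (MvPolynomial.X 2 : Poly) ^ 2] P
  formB : B = MvPolynomial.X 2 *
    MvPolynomial.aeval ![MvPolynomial.X 0, MvPolynomial.X 1, (MvPolynomial.X 2 : Poly) ^ 2] Q

/-- `x : ℝ → ℝ³` is a (global) solution of the perturbed Euler top
`x₁' = α x₂ x₃ + ε A`, `x₂' = β x₁ x₃ + ε B`, `x₃' = γ x₁ x₂ + ε C`. -/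
def IsSolution (α β γ ε : ℝ) (A B C : Poly) (x : ℝ → Space) : Prop :=
  ∀ t : ℝ,
    HasDerivAt (fun s => x s 0)
      (α * x t 1 * x t 2 + ε * val A (x t 0) (x t 1) (x t 2)) t ∧
    HasDerivAt (fun s => x s 1)
      (β * x t 0 * x t 2 + ε * val B (x t 0) (x t 1) (x t 2)) t ∧
    HasDerivAt (fun s => x s 2)
      (γ * x t 0 * x t 1 + ε * val C (x t 0) (x t 1) (x t 2)) t

/-- `Γ` is a periodic orbit: the orbit of a nonconstant periodic solution. -/
def IsPeriodicOrbit (α β γ ε : ℝ) (A B C : Poly) (Γ : Set Space) : Prop :=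
  ∃ x : ℝ → Space, IsSolution α β γ ε A B C x ∧ (∃ T : ℝ, 0 < T ∧ Function.Periodic x T) ∧
    (∃ s t : ℝ, x s ≠ x t) ∧ Γ = Set.range x

/-- `Γ` is a limit cycle: a periodic orbit that is the `ω`-limit set or the `α`-limit set of
another orbit. (All solutions are global when the field is tangent to the spheres.) -/
def IsLimitCycle (α β γ ε : ℝ) (A B C : Poly) (Γ : Set Space) : Prop :=
  IsPeriodicOrbit α β γ ε A B C Γ ∧
    ∃ y : ℝ → Space, IsSolution α β γ ε A B C y ∧ Set.range y ≠ Γ ∧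
      (Γ = {p | MapClusterPt p atTop y} ∨ Γ = {p | MapClusterPt p atBot y})

/-- The open upper hemisphere of radius `c`. -/
def upperHemisphere (c : ℝ) : Set Space :=
  {x | x 0 ^ 2 + x 1 ^ 2 + x 2 ^ 2 = c ^ 2 ∧ 0 < x 2}

/-- The level set `H = h` in the upper hemisphere, where `H(x, y) = (α y² - β x²) / 2`. -/
def oval (α β c h : ℝ) : Set Space :=
  {x | x ∈ upperHemisphere c ∧ (α * x 1 ^ 2 - β * x 0 ^ 2) / 2 = h}

/-- The values `h` for which `H = h` is an ellipse contained in the open disk `x² + y² < c²`: these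
label the periodic orbits of the unperturbed system contained in the upper hemisphere. -/
def annulus (α β c : ℝ) : Set ℝ :=
  {h | 0 < α * h ∧ -2 * h / β < c ^ 2 ∧ 2 * h / α < c ^ 2}

/-- The line integral `∮_{H = h} F dy - G dx` over the ellipse `H = h`, parametrized by
`x = √(-2h/β) cos θ`, `y = √(2h/α) sin θ`. -/
def ellipseIntegral (α β : ℝ) (F G : ℝ → ℝ → ℝ) (h : ℝ) : ℝ :=
  ∫ θ in (0 : ℝ)..(2 * Real.pi),
    (F (√(-2 * h / β) * Real.cos θ) (√(2 * h / α) * Real.sin θ) * (√(2 * h / α) * Real.cos θ) -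
     G (√(-2 * h / β) * Real.cos θ) (√(2 * h / α) * Real.sin θ) * -(√(-2 * h / β) * Real.sin θ))

/-- The Poincaré--Pontryagin function, written through `P` and `Q`:
`I(h) = ∮_{H = h} P(x, y, c² - x² - y²) dy - Q(x, y, c² - x² - y²) dx`, for all `h` for which
`H = h` is an ellipse (`α h > 0`). -/
def poincarePontryagin (α β c : ℝ) (P Q : Poly) (h : ℝ) : ℝ :=
  ellipseIntegral α β (fun x y => val P x y (c ^ 2 - (x ^ 2 + y ^ 2)))
    (fun x y => val Q x y (c ^ 2 - (x ^ 2 + y ^ 2))) h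

/-- `N` limit cycles of the perturbed system contained in the upper hemisphere of radius `c`
bifurcate, as `ε → 0` along the filter `l`, from periodic orbits of the unperturbed system in that
hemisphere: there are `N` families `Γ i ε` that for all relevant `ε` are pairwise different limit
cycles, and `Γ i ε` tends to `oval α β c (h i)` in the Hausdorff distance. -/
def LimitCyclesBifurcate (α β γ c : ℝ) (A B C : Poly) (l : Filter ℝ) (N : ℕ) : Prop :=
  ∃ (h : Fin N → ℝ) (Γ : Fin N → ℝ → Set Space),
    (∀ i, h i ∈ annulus α β c) ∧
    (∀ᶠ ε in l, (∀ i, IsLimitCycle α β γ ε A B C (Γ i ε) ∧ Γ i ε ⊆ upperHemisphere c) ∧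
      ∀ i j, i ≠ j → Γ i ε ≠ Γ j ε) ∧
    ∀ i, Tendsto (fun ε => Metric.hausdorffEDist (Γ i ε) (oval α β c (h i))) l (𝓝 0)

/-- On the period annulus, `poincarePontryagin` is the line integral of
`(A dy - B dx) / √(c² - (x² + y²))` with `A`, `B` taken at `(x, y, √(c² - (x² + y²)))`. -/
theorem poincarePontryagin_eq {α β c : ℝ} (hαβ : α * β < 0) {m : ℕ} {A B C P Q : Poly}
    (hp : IsPerturbation m A B C P Q) {h : ℝ} (hh : h ∈ annulus α β c) :
    poincarePontryagin α β c P Q h =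
      ellipseIntegral α β
        (fun x y => val A x y √(c ^ 2 - (x ^ 2 + y ^ 2)) / √(c ^ 2 - (x ^ 2 + y ^ 2)))
        (fun x y => val B x y √(c ^ 2 - (x ^ 2 + y ^ 2)) / √(c ^ 2 - (x ^ 2 + y ^ 2))) h := by
  obtain ⟨h0, h1, h2⟩ := hh
  have ha : 0 ≤ -2 * h / β := by
    rcases lt_or_gt_of_ne (show β ≠ 0 by rintro rfl; simp at hαβ) with hb | hb
    · have : 0 < h := by
        by_contra hn
        have : 0 < α := by nlinarith
        nlinarith
      exact div_nonneg_of_nonpos (by linarith) hb.le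
    · have : h < 0 := by
        by_contra hn
        have : α < 0 := by nlinarith
        nlinarith
      exact div_nonneg (by linarith) hb.le
  have hb : 0 ≤ 2 * h / α := by
    have hα : α ≠ 0 := by rintro rfl; simp at hαβ
    have : 2 * h / α = 2 * (α * h) / α ^ 2 := by field_simp
    rw [this]; positivity
  have key : ∀ (F S : Poly), F = MvPolynomial.X 2 * MvPolynomial.aeval
      ![MvPolynomial.X 0, MvPolynomial.X 1, (MvPolynomial.X 2 : Poly) ^ 2] S →
      ∀ x y : ℝ, 0 < c ^ 2 - (x ^ 2 + y ^ 2) →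
      val F x y √(c ^ 2 - (x ^ 2 + y ^ 2)) / √(c ^ 2 - (x ^ 2 + y ^ 2)) =
        val S x y (c ^ 2 - (x ^ 2 + y ^ 2)) := by
    intro F S hF x y hs
    have hs' := Real.sqrt_pos.2 hs
    subst hF
    unfold val
    rw [MvPolynomial.eval_mul, MvPolynomial.eval_X]
    have e : ∀ s : ℝ, MvPolynomial.eval ![x, y, s] (MvPolynomial.aeval
        ![MvPolynomial.X 0, MvPolynomial.X 1, (MvPolynomial.X 2 : Poly) ^ 2] S) =
        MvPolynomial.eval ![x, y, s ^ 2] S := by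
      intro s
      induction S using MvPolynomial.induction_on with
      | C a => simp
      | add p q hp hq => rw [map_add, map_add, hp, hq, map_add]
      | mul_X p i hp =>
        rw [map_mul, map_mul, hp, map_mul, MvPolynomial.aeval_X, MvPolynomial.eval_X]
        fin_cases i <;> simp
    rw [e, Real.sq_sqrt hs.le]
    simp only [Matrix.cons_val]
    field_simp
  unfold poincarePontryagin ellipseIntegral
  refine intervalIntegral.integral_congr (fun θ _ => ?_)
  have hs : 0 < c ^ 2 - ((√(-2 * h / β) * Real.cos θ) ^ 2 + (√(2 * h / α) * Real.sin θ) ^ 2) := by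
    rw [mul_pow, mul_pow, Real.sq_sqrt ha, Real.sq_sqrt hb]
    have := Real.sin_sq_add_cos_sq θ
    rcases le_total (-2 * h / β) (2 * h / α) with hle | hle
    · nlinarith [sq_nonneg (Real.sin θ), sq_nonneg (Real.cos θ)]
    · nlinarith [sq_nonneg (Real.sin θ), sq_nonneg (Real.cos θ)]
  simp only [key A P hp.formA _ _ hs, key B Q hp.formB _ _ hs]

end EulerTop

end

noncomputable section

namespace EulerTop

/-! Everything rests on the weights forced by the shape of A and B. Since x₃P(x₁,x₂,x₃²) is
homogeneous of degree m, every monomial of P has weight m - 1 for the weights 1, 1, 2, and likewise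
for Q. If m is odd, P and Q are therefore even in (x, y), the integrand of I changes sign under a
half-turn, and I vanishes identically (`poincarePontryagin_eq_zero`); this is (i), and it makes
(iii) vacuous. If m = 2k + 2, integrating monomial by monomial over the ellipse, with r² = 2αh,
gives I(h) = h M(h) with deg M ≤ k (`exists_polynomial_radialIntegral`).

Upper bound. On the hemisphere x₃ factors out of the first two equations, so up to a change of time
the orbits are those of a perturbed planar linear centre, and in scaled polar coordinates they
satisfy dr/dθ = ε `polarSlope`. Over one turn r grows by ε D(r, ε) with D smooth, and D(r, 0) is a
nonzero constant times r M(r²), where M is now a polynomial in r². A periodic orbit Hausdorff-close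
to an oval yields a zero of D(·, ε), and different orbits yield different zeros
(`exists_displacement_of_oval`). By Rolle the number of zeros near r is at most the multiplicity of
r² as a root of M (`card_le_rootMultiplicity`). Summing over the roots gives N ≤ deg M ≤ k
(`le_natDegree_of_bifurcate`). For n = m - 1 = 2k + 1 and k ≥ 1 this is less than n - 1 = 2k.

Lower bound. If the field is radial on the sphere with a factor σ(H), the equation for H decouples:
up to a change of time, H' = 2εσ(H)H. Zeros of σ are then periodic orbits for every ε, and explicit
heteroclinic solutions of this scalar equation show that they are limit cycles
(`isLimitCycle_oval`). The factors H - a and (H - a)(H - 2a) give one and two of them. -/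

/-! ### Weighted homogeneity of P and Q. -/

open MvPolynomial in
/-- Substituting `x₃²` for `x₃` in a monomial doubles its last exponent. -/
theorem aeval_sq_monomial (d : Fin 3 →₀ ℕ) (a : ℝ) :
    aeval ![X 0, X 1, (X 2 : Poly) ^ 2] (monomial d a) =
      monomial (d + Finsupp.single 2 (d 2)) a := by
  rw [aeval_monomial, Finsupp.prod_fintype _ _ (by simp), Fin.prod_univ_three,
    monomial_eq (s := d + _), Finsupp.prod_fintype _ _ (by simp), Fin.prod_univ_three]
  simp only [Finsupp.add_apply, Matrix.cons_val, Finsupp.single_apply, algebraMap_eq]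
  simp
  left
  ring

open MvPolynomial in
/-- The coefficients after the substitution of `x₃²` for `x₃`. -/
theorem coeff_aeval_sq (P : Poly) (d : Fin 3 →₀ ℕ) :
    coeff (d + Finsupp.single 2 (d 2)) (aeval ![X 0, X 1, (X 2 : Poly) ^ 2] P) = coeff d P := by
  -- Doubling the last exponent is injective on exponents, so monomials of P never merge or cancel
  -- after the substitution.
  have inj : ∀ e : Fin 3 →₀ ℕ, e + Finsupp.single 2 (e 2) = d + Finsupp.single 2 (d 2) ↔ e = d := by
    intro e
    refine ⟨fun h => ?_, fun h => by rw [h]⟩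
    ext i
    have := DFunLike.congr_fun h i
    fin_cases i <;> simp at this ⊢ <;> omega
  conv_lhs => rw [P.as_sum, map_sum, coeff_sum]
  simp only [aeval_sq_monomial, coeff_monomial, inj]
  rw [Finset.sum_ite_eq']
  split_ifs with h
  · rfl
  · exact (notMem_support_iff.1 h).symm

open MvPolynomial in
/-- If `x₃ P(x₁, x₂, x₃²)` is homogeneous of degree `n + 1`, then `P` is weighted homogeneous of
degree `n` for the weights `1, 1, 2`. -/
theorem weight_eq_of_isHomogeneous {n : ℕ} {A P : Poly} (hA : A.IsHomogeneous (n + 1))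
    (h : A = X 2 * aeval ![X 0, X 1, (X 2 : Poly) ^ 2] P) {d : Fin 3 →₀ ℕ} (hd : d ∈ P.support) :
    d 0 + d 1 + 2 * d 2 = n := by
  -- A monomial d of P becomes the monomial of A with exponents d₀, d₁, 2d₂ + 1, and its degree is
  -- known.
  have h1 : coeff (Finsupp.single 2 1 + (d + Finsupp.single 2 (d 2))) A ≠ 0 := by
    rw [h, coeff_X_mul, coeff_aeval_sq]
    exact mem_support_iff.1 hd
  have h2 := hA h1
  rw [Finsupp.weight_apply, Finsupp.sum_fintype _ _ (by simp), Fin.sum_univ_three] at h2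
  simp at h2
  omega

open MvPolynomial in
theorem totalDegree_le_of_weight {n : ℕ} {P : Poly}
    (h : ∀ d ∈ P.support, d 0 + d 1 + 2 * d 2 = n) : P.totalDegree ≤ n := by
  refine Finset.sup_le fun d hd => ?_
  rw [Finsupp.sum_fintype _ _ (by simp), Fin.sum_univ_three]
  have := h d hd
  omega

theorem val_eq_sum (P : Poly) (x y z : ℝ) :
    val P x y z = ∑ d ∈ P.support, P.coeff d * (x ^ d 0 * y ^ d 1 * z ^ d 2) := by
  unfold val
  rw [MvPolynomial.eval_eq']
  simp [Fin.prod_univ_three]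

theorem continuous_val (P : Poly) {X : Type*} [TopologicalSpace X] {f g k : X → ℝ}
    (hf : Continuous f) (hg : Continuous g) (hk : Continuous k) :
    Continuous fun t => val P (f t) (g t) (k t) := by
  simp only [val_eq_sum]
  fun_prop

/-! ### Integrals over circles: polynomial dependence on r² and vanishing by parity. -/

/-- `∫ g (e - q w)ᵏ` is a polynomial in `q` of degree at most `k`. -/
theorem exists_polynomial_integral_mul_pow (k : ℕ) (e a b : ℝ) {w : ℝ → ℝ} (hw : Continuous w) :
    ∀ {g : ℝ → ℝ}, Continuous g → ∃ W : Polynomial ℝ, W.natDegree ≤ k ∧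
      ∀ q : ℝ, ∫ θ in a..b, g θ * (e - q * w θ) ^ k = W.eval q := by
  induction k with
  | zero => exact fun {g} _ => ⟨Polynomial.C (∫ θ in a..b, g θ), by simp, by simp⟩
  | succ k ih =>
    intro g hg
    -- One factor e - q w is split off and its two terms are absorbed into the weight g; the
    -- induction therefore runs over all g at once.
    obtain ⟨W, hW, hW'⟩ := ih (g := fun θ => g θ * e) (by fun_prop)
    obtain ⟨V, hV, hV'⟩ := ih (g := fun θ => g θ * w θ) (by fun_prop)
    refine ⟨W - Polynomial.X * V, ?_, fun q => ?_⟩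
    · refine (Polynomial.natDegree_sub_le _ _).trans (max_le (by omega) ?_)
      refine Polynomial.natDegree_mul_le.trans ?_
      have := Polynomial.natDegree_X_le (R := ℝ)
      omega
    · simp only [Polynomial.eval_sub, Polynomial.eval_mul, Polynomial.eval_X, ← hW', ← hV']
      rw [← intervalIntegral.integral_const_mul, ← intervalIntegral.integral_sub]
      · congr 1
        ext θ
        ring
      · exact Continuous.intervalIntegrable (by fun_prop) _ _
      · exact Continuous.intervalIntegrable (by fun_prop) _ _

/-- The integral of a weighted homogeneous polynomial of odd degree over the circles of radius `r`,
against a multiple of `r`. -/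
theorem exists_polynomial_integral_val {k : ℕ} {P : Poly}
    (hP : ∀ d ∈ P.support, d 0 + d 1 + 2 * d 2 = 2 * k + 1) (e a b : ℝ) {f g w t : ℝ → ℝ}
    (hf : Continuous f) (hg : Continuous g) (hw : Continuous w) (ht : Continuous t) :
    ∃ M : Polynomial ℝ, M.natDegree ≤ k ∧ ∀ r : ℝ,
      ∫ θ in a..b, val P (r * f θ) (r * g θ) (e - r ^ 2 * w θ) * (r * t θ) =
        r ^ 2 * M.eval (r ^ 2) := by
  have key : ∀ d ∈ P.support, ∃ M : Polynomial ℝ, M.natDegree ≤ k ∧ ∀ r : ℝ,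
      ∫ θ in a..b, P.coeff d * ((r * f θ) ^ d 0 * (r * g θ) ^ d 1 * (e - r ^ 2 * w θ) ^ d 2) *
        (r * t θ) = r ^ 2 * M.eval (r ^ 2) := by
    intro d hd
    have hd' := hP d hd
    -- The weight is odd, so d₀ + d₁ is odd; with the extra factor r the power of r outside the
    -- integral is r²(r²)ʲ, and j + d₂ = k bounds the degree.
    obtain ⟨j, hj⟩ : ∃ j, d 0 + d 1 = 2 * j + 1 := ⟨k - d 2, by omega⟩
    obtain ⟨W, hW, hW'⟩ := exists_polynomial_integral_mul_pow (d 2) e a b hw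
      (g := fun θ => P.coeff d * (f θ ^ d 0 * g θ ^ d 1) * t θ) (by fun_prop)
    refine ⟨Polynomial.X ^ j * W, ?_, fun r => ?_⟩
    · refine Polynomial.natDegree_mul_le.trans ?_
      rw [Polynomial.natDegree_X_pow]
      omega
    · rw [Polynomial.eval_mul, Polynomial.eval_pow, Polynomial.eval_X, ← hW', ← mul_assoc,
        ← intervalIntegral.integral_const_mul]
      congr 1
      ext θ
      have : r ^ 2 * (r ^ 2) ^ j = r ^ d 0 * r ^ d 1 * r := by
        rw [← pow_add, hj]; ring
      rw [this]
      ring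
  choose! M hM hM' using key
  refine ⟨∑ d ∈ P.support, M d, Polynomial.natDegree_sum_le_of_forall_le _ _ hM, fun r => ?_⟩
  simp only [val_eq_sum, Finset.sum_mul]
  rw [intervalIntegral.integral_finsetSum, Polynomial.eval_finsetSum, Finset.mul_sum]
  · exact Finset.sum_congr rfl fun d hd => hM' d hd r
  · exact fun d _ => Continuous.intervalIntegrable (by fun_prop) _ _

/-- A weighted homogeneous polynomial of even degree is even in `(x, y)`. -/
theorem val_neg_of_even {k : ℕ} {P : Poly} (hP : ∀ d ∈ P.support, d 0 + d 1 + 2 * d 2 = 2 * k)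
    (x y z : ℝ) : val P (-x) (-y) z = val P x y z := by
  simp only [val_eq_sum]
  refine Finset.sum_congr rfl fun d hd => ?_
  have h : Even (d 0 + d 1) := ⟨k - d 2, by have := hP d hd; omega⟩
  rw [neg_pow x, neg_pow y,
    show (-1) ^ d 0 * x ^ d 0 * ((-1) ^ d 1 * y ^ d 1) * z ^ d 2 =
      (-1) ^ (d 0 + d 1) * (x ^ d 0 * y ^ d 1 * z ^ d 2) by ring, h.neg_one_pow, one_mul]

theorem integral_eq_zero_of_antiperiodic {f : ℝ → ℝ} (hf : Function.Antiperiodic f Real.pi)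
    (hc : Continuous f) : ∫ θ in (0 : ℝ)..(2 * Real.pi), f θ = 0 := by
  rw [← intervalIntegral.integral_add_adjacent_intervals (b := Real.pi)
    (hc.intervalIntegrable _ _) (hc.intervalIntegrable _ _)]
  have h := intervalIntegral.integral_comp_add_right (a := 0) (b := Real.pi) f Real.pi
  simp only [hf _, intervalIntegral.integral_neg, zero_add, ← two_mul] at h
  rw [← h]
  ring

/-- For odd `m` the Poincaré--Pontryagin function vanishes identically. -/
theorem poincarePontryagin_eq_zero {m k : ℕ} (hm : m = 2 * k + 1) {A B C P Q : Poly}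
    (hp : IsPerturbation m A B C P Q) (α β c h : ℝ) : poincarePontryagin α β c P Q h = 0 := by
  subst hm
  have hP : ∀ d ∈ P.support, d 0 + d 1 + 2 * d 2 = 2 * k :=
    fun d hd => weight_eq_of_isHomogeneous hp.homA hp.formA hd
  have hQ : ∀ d ∈ Q.support, d 0 + d 1 + 2 * d 2 = 2 * k :=
    fun d hd => weight_eq_of_isHomogeneous hp.homB hp.formB hd
  unfold poincarePontryagin ellipseIntegral
  -- A half-turn replaces (x, y) by (-x, -y): P and Q are unchanged, while dx and dy change sign.
  refine integral_eq_zero_of_antiperiodic (fun θ => ?_) ?_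
  · simp only [Real.cos_add_pi, Real.sin_add_pi, mul_neg, val_neg_of_even hP, val_neg_of_even hQ,
      neg_sq]
    ring
  · have h1 := continuous_val P (f := fun θ => √(-2 * h / β) * Real.cos θ)
      (g := fun θ => √(2 * h / α) * Real.sin θ)
      (k := fun θ => c ^ 2 - ((√(-2 * h / β) * Real.cos θ) ^ 2 +
        (√(2 * h / α) * Real.sin θ) ^ 2)) (by fun_prop) (by fun_prop) (by fun_prop)
    have h2 := continuous_val Q (f := fun θ => √(-2 * h / β) * Real.cos θ)
      (g := fun θ => √(2 * h / α) * Real.sin θ)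
      (k := fun θ => c ^ 2 - ((√(-2 * h / β) * Real.cos θ) ^ 2 +
        (√(2 * h / α) * Real.sin θ) ^ 2)) (by fun_prop) (by fun_prop) (by fun_prop)
    fun_prop

/-! ### Scaled polar coordinates in which the linear centre is a rotation. -/

/-- The semi-axis in the `x`-direction of the ellipse `2 α H = 1`. -/
def semiX (α β : ℝ) : ℝ := 1 / √(-(α * β))

/-- The semi-axis in the `y`-direction of the ellipse `2 α H = 1`. -/
def semiY (α : ℝ) : ℝ := 1 / |α|

/-- The angular velocity of the linear centre `x' = α y`, `y' = β x` in the coordinates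
`x = semiX r cos θ`, `y = semiY r sin θ`. -/
def freq (α β : ℝ) : ℝ := -(α * semiY α) / semiX α β

theorem alpha_ne {α β : ℝ} (hαβ : α * β < 0) : α ≠ 0 := by rintro rfl; simp at hαβ
theorem beta_ne {α β : ℝ} (hαβ : α * β < 0) : β ≠ 0 := by rintro rfl; simp at hαβ

theorem semiX_pos {α β : ℝ} (hαβ : α * β < 0) : 0 < semiX α β :=
  one_div_pos.2 (Real.sqrt_pos.2 (by linarith))
theorem semiY_pos {α β : ℝ} (hαβ : α * β < 0) : 0 < semiY α :=
  one_div_pos.2 (abs_pos.2 (alpha_ne hαβ))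

theorem semiX_sq {α β : ℝ} (hαβ : α * β < 0) : semiX α β ^ 2 = -(1 / (α * β)) := by
  unfold semiX
  rw [div_pow, Real.sq_sqrt (by linarith), one_pow]
  have := alpha_ne hαβ
  have := beta_ne hαβ
  field_simp

theorem semiY_sq (α : ℝ) : semiY α ^ 2 = 1 / α ^ 2 := by
  unfold semiY
  rw [div_pow, sq_abs, one_pow]

/-- With `beta_mul_semiX` this turns x' = αy, y' = βx into u' = -ωv, v' = ωu for ω = `freq α β`,
where x = `semiX` u and y = `semiY` v. The sign of ω is opposite to that of α. -/
theorem alpha_mul_semiY {α β : ℝ} (hαβ : α * β < 0) : α * semiY α = -(freq α β * semiX α β) := by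
  unfold freq
  have := (semiX_pos hαβ).ne'
  field_simp

theorem beta_mul_semiX {α β : ℝ} (hαβ : α * β < 0) : β * semiX α β = freq α β * semiY α := by
  have hx := (semiX_pos hαβ).ne'
  have := alpha_ne hαβ
  have := beta_ne hαβ
  have h1 := semiX_sq hαβ
  have h2 := semiY_sq α
  unfold freq
  rw [eq_comm, div_mul_eq_mul_div, div_eq_iff hx]
  have : β * semiX α β * semiX α β = β * semiX α β ^ 2 := by ring
  rw [this, h1, show -(α * semiY α) * semiY α = -(α * semiY α ^ 2) by ring, h2]
  field_simp

theorem freq_ne {α β : ℝ} (hαβ : α * β < 0) : freq α β ≠ 0 := by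
  exact div_ne_zero (neg_ne_zero.2 (mul_ne_zero (alpha_ne hαβ) (semiY_pos hαβ).ne'))
    (semiX_pos hαβ).ne'

theorem sqrt_two_mul_div_alpha {α β : ℝ} (hαβ : α * β < 0) {h : ℝ} (hh : 0 < α * h) :
    √(2 * h / α) = √(2 * (α * h)) * semiY α := by
  have := alpha_ne hαβ
  rw [← Real.sqrt_sq (semiY_pos hαβ).le, ← Real.sqrt_mul (by positivity), semiY_sq α]
  congr 1
  field_simp

theorem sqrt_neg_two_mul_div_beta {α β : ℝ} (hαβ : α * β < 0) {h : ℝ} (hh : 0 < α * h) :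
    √(-2 * h / β) = √(2 * (α * h)) * semiX α β := by
  have := alpha_ne hαβ
  have := beta_ne hαβ
  rw [← Real.sqrt_sq (semiX_pos hαβ).le, ← Real.sqrt_mul (by positivity), semiX_sq hαβ]
  congr 1
  field_simp

/-- The oval H = h thus becomes the circle of radius r = √(2αh), whatever the sign of α. -/
theorem H_polar {α β : ℝ} (hαβ : α * β < 0) (r θ : ℝ) :
    (α * (semiY α * (r * Real.sin θ)) ^ 2 - β * (semiX α β * (r * Real.cos θ)) ^ 2) / 2 =
      r ^ 2 / (2 * α) := by
  have := alpha_ne hαβ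
  have := beta_ne hαβ
  have h := Real.sin_sq_add_cos_sq θ
  simp only [mul_pow, semiX_sq hαβ, semiY_sq α]
  field_simp
  linear_combination r ^ 2 * h

/-- The Melnikov integral `∮ (cos θ P / a + sin θ Q / b) dθ` over the circle of radius `r` in the
coordinates `x = a r cos θ`, `y = b r sin θ`. -/
def radialIntegral (α β c : ℝ) (P Q : Poly) (r : ℝ) : ℝ :=
  ∫ θ in (0 : ℝ)..(2 * Real.pi),
    (val P (semiX α β * (r * Real.cos θ)) (semiY α * (r * Real.sin θ))
        (c ^ 2 - ((semiX α β * (r * Real.cos θ)) ^ 2 + (semiY α * (r * Real.sin θ)) ^ 2)) *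
        (Real.cos θ / semiX α β) +
      val Q (semiX α β * (r * Real.cos θ)) (semiY α * (r * Real.sin θ))
        (c ^ 2 - ((semiX α β * (r * Real.cos θ)) ^ 2 + (semiY α * (r * Real.sin θ)) ^ 2)) *
        (Real.sin θ / semiY α))

/-- On the ellipse x = a r cos θ, y = b r sin θ, the form P dy - Q dx equals ab r (P cos θ / a + Q
sin θ / b) dθ. Hence I and the first-order radial displacement have the same zeros. -/
theorem poincarePontryagin_eq_radialIntegral {α β : ℝ} (hαβ : α * β < 0) (c : ℝ) (P Q : Poly)
    {h : ℝ} (hh : 0 < α * h) :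
    poincarePontryagin α β c P Q h = semiX α β * semiY α *
      (√(2 * (α * h)) * radialIntegral α β c P Q √(2 * (α * h))) := by
  have hx := (semiX_pos hαβ).ne'
  have hy := (semiY_pos hαβ).ne'
  unfold poincarePontryagin ellipseIntegral radialIntegral
  rw [sqrt_two_mul_div_alpha hαβ hh, sqrt_neg_two_mul_div_beta hαβ hh,
    ← intervalIntegral.integral_const_mul, ← intervalIntegral.integral_const_mul]
  congr 1
  ext θ
  generalize √(2 * (α * h)) = r
  rw [show r * semiX α β * Real.cos θ = semiX α β * (r * Real.cos θ) by ring,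
    show r * semiY α * Real.sin θ = semiY α * (r * Real.sin θ) by ring]
  field_simp
  ring

/-- For even `m` the Melnikov integral is given by an even polynomial. -/
theorem exists_polynomial_radialIntegral {m k : ℕ} (hm : m = 2 * k + 2) {A B C P Q : Poly}
    (hp : IsPerturbation m A B C P Q) (α β c : ℝ) :
    ∃ M : Polynomial ℝ, M.natDegree ≤ k ∧ ∀ r : ℝ,
      r * radialIntegral α β c P Q r = r ^ 2 * M.eval (r ^ 2) := by
  subst hm
  have hP : ∀ d ∈ P.support, d 0 + d 1 + 2 * d 2 = 2 * k + 1 :=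
    fun d hd => weight_eq_of_isHomogeneous hp.homA hp.formA hd
  have hQ : ∀ d ∈ Q.support, d 0 + d 1 + 2 * d 2 = 2 * k + 1 :=
    fun d hd => weight_eq_of_isHomogeneous hp.homB hp.formB hd
  have hf : Continuous fun θ => semiX α β * Real.cos θ := by fun_prop
  have hg : Continuous fun θ => semiY α * Real.sin θ := by fun_prop
  have hw : Continuous fun θ => (semiX α β * Real.cos θ) ^ 2 + (semiY α * Real.sin θ) ^ 2 := by
    fun_prop
  have hs : Continuous fun θ => Real.sin θ / semiY α := by fun_prop
  have hc : Continuous fun θ => Real.cos θ / semiX α β := by fun_prop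
  obtain ⟨M, hM, hM'⟩ := exists_polynomial_integral_val hP (c ^ 2) 0 (2 * Real.pi) hf hg hw hc
  obtain ⟨L, hL, hL'⟩ := exists_polynomial_integral_val hQ (c ^ 2) 0 (2 * Real.pi) hf hg hw hs
  refine ⟨M + L, (Polynomial.natDegree_add_le _ _).trans (max_le hM hL), fun r => ?_⟩
  rw [Polynomial.eval_add, mul_add, ← hM', ← hL', ← intervalIntegral.integral_add]
  · unfold radialIntegral
    rw [← intervalIntegral.integral_const_mul]
    congr 1
    ext θ
    rw [show r * (semiX α β * Real.cos θ) = semiX α β * (r * Real.cos θ) by ring,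
      show r * (semiY α * Real.sin θ) = semiY α * (r * Real.sin θ) by ring,
      show r ^ 2 * ((semiX α β * Real.cos θ) ^ 2 + (semiY α * Real.sin θ) ^ 2) =
        (semiX α β * (r * Real.cos θ)) ^ 2 + (semiY α * (r * Real.sin θ)) ^ 2 by ring]
    ring
  · refine Continuous.intervalIntegrable (Continuous.mul (continuous_val P ?_ ?_ ?_) ?_) _ _ <;>
      fun_prop
  · refine Continuous.intervalIntegrable (Continuous.mul (continuous_val Q ?_ ?_ ?_) ?_) _ _ <;>
      fun_prop

/-! ### Counting zeros of a perturbed function near a multiple root. -/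

/-- Rolle: between `p + 2` zeros there are `p + 1` zeros of the derivative. -/
theorem exists_strictMono_deriv_eq_zero {p : ℕ} {f : ℝ → ℝ} {r δ : ℝ}
    (hf : ∀ a, |a - r| < δ → DifferentiableAt ℝ f a) {z : Fin (p + 2) → ℝ} (hz : StrictMono z)
    (h : ∀ i, |z i - r| < δ ∧ f (z i) = 0) :
    ∃ w : Fin (p + 1) → ℝ, StrictMono w ∧ ∀ i, |w i - r| < δ ∧ deriv f (w i) = 0 := by
  have mem : ∀ i : Fin (p + 1), ∀ a ∈ Set.Icc (z i.castSucc) (z i.succ), |a - r| < δ := by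
    intro i a ha
    have h1 := abs_lt.1 (h i.castSucc).1
    have h2 := abs_lt.1 (h i.succ).1
    exact abs_lt.2 ⟨by linarith [ha.1], by linarith [ha.2]⟩
  have key : ∀ i : Fin (p + 1), ∃ a ∈ Set.Ioo (z i.castSucc) (z i.succ), deriv f a = 0 :=
    fun i => exists_deriv_eq_zero (hz i.castSucc_lt_succ)
      (fun a ha => (hf a (mem i a ha)).continuousAt.continuousWithinAt)
      ((h _).2.trans (h _).2.symm)
  choose w hw hw' using key
  refine ⟨w, fun i j hij => ?_, fun i => ⟨mem i _ (Set.Ioo_subset_Icc_self (hw i)), hw' i⟩⟩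
  exact (hw i).2.trans_le ((hz.monotone (Fin.succ_le_castSucc_iff.2 hij)).trans (hw j).1.le)

/-- If `D(·, ε)` has `p + 1` zeros near `r` for `ε` near `0`, then the `p`-th derivative of
`D(·, 0)` vanishes at `r`. -/
theorem iteratedDeriv_eq_zero_of_zeros (r : ℝ) (p : ℕ) : ∀ {D : ℝ × ℝ → ℝ},
    ContDiffAt ℝ (p + 1 : ℕ) D (r, 0) →
    (∀ δ > 0, ∃ ε, |ε| < δ ∧ ∃ z : Fin (p + 1) → ℝ, StrictMono z ∧
      ∀ i, |z i - r| < δ ∧ D (z i, ε) = 0) →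
    iteratedDeriv p (fun a => D (a, 0)) r = 0 := by
  induction p with
  | zero =>
    intro D hD h
    rw [iteratedDeriv_zero]
    by_contra hne
    have hev := hD.continuousAt.eventually_ne hne
    obtain ⟨δ, hδ, hδ'⟩ := Metric.eventually_nhds_iff.1 hev
    obtain ⟨ε, hε, z, -, hz⟩ := h δ hδ
    refine hδ' (y := (z 0, ε)) ?_ (hz 0).2
    rw [Prod.dist_eq]
    exact max_lt (by simpa [Real.dist_eq] using (hz 0).1) (by simpa [Real.dist_eq] using hε)
  | succ p ih =>
    intro D hD h
    have hdiff : ∀ᶠ v in 𝓝 (r, (0 : ℝ)), DifferentiableAt ℝ D v := by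
      filter_upwards [hD.eventually (by simp)] with v hv
      exact hv.differentiableAt (by simp)
    have hderiv : ∀ v : ℝ × ℝ, DifferentiableAt ℝ D v →
        HasDerivAt (fun a => D (a, v.2)) (fderiv ℝ D v (1, 0)) v.1 := by
      intro v hv
      have h1 : HasDerivAt (fun a : ℝ => (a, v.2)) ((1 : ℝ), (0 : ℝ)) v.1 :=
        (hasDerivAt_id v.1).prodMk (hasDerivAt_const _ _)
      exact hv.hasFDerivAt.comp_hasDerivAt v.1 h1
    obtain ⟨δ₀, hδ₀, hδ₀'⟩ := Metric.eventually_nhds_iff.1 hdiff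
    have near : ∀ {δ a ε : ℝ}, δ ≤ δ₀ → |a - r| < δ → |ε| < δ → DifferentiableAt ℝ D (a, ε) := by
      intro δ a ε hδ ha hε
      refine hδ₀' ?_
      rw [Prod.dist_eq]
      exact (max_lt (by simpa [Real.dist_eq] using ha) (by simpa [Real.dist_eq] using hε)).trans_le
        hδ
    have hD' : ContDiffAt ℝ (p + 1 : ℕ) (fun v => fderiv ℝ D v (1, 0)) (r, 0) :=
      (hD.fderiv_right (m := (p + 1 : ℕ)) (by norm_cast)).clm_apply contDiffAt_const
    -- The induction passes to ∂D/∂a: by Rolle it has one zero fewer near r for the same ε, and it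
    -- is one degree less smooth.
    have := ih hD' fun δ hδ => by
      obtain ⟨ε, hε, z, hz, hz'⟩ := h (min δ δ₀) (lt_min hδ hδ₀)
      obtain ⟨w, hw, hw'⟩ := exists_strictMono_deriv_eq_zero (f := fun a => D (a, ε))
        (fun a ha => (hderiv (a, ε) (near (min_le_right _ _) ha hε)).differentiableAt) hz hz'
      refine ⟨ε, hε.trans_le (min_le_left _ _), w, hw, fun i =>
        ⟨(hw' i).1.trans_le (min_le_left _ _), ?_⟩⟩
      rw [← (hderiv (w i, ε) (near (min_le_right _ _) (hw' i).1 hε)).deriv]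
      exact (hw' i).2
    rw [iteratedDeriv_succ']
    refine Eq.trans ?_ this
    refine Filter.EventuallyEq.iteratedDeriv_eq _ ?_
    filter_upwards [Metric.ball_mem_nhds r hδ₀] with a ha
    exact (hderiv (a, 0) (near le_rfl (by simpa [Real.dist_eq] using ha) (by simpa))).deriv

theorem iteratedDeriv_polynomial (W : Polynomial ℝ) (n : ℕ) :
    iteratedDeriv n (fun a => W.eval a) = fun a => (Polynomial.derivative^[n] W).eval a := by
  induction n generalizing W with
  | zero => simp
  | succ n ih =>
    rw [iteratedDeriv_succ', Function.iterate_succ_apply, ← ih]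
    congr 1
    ext a
    exact W.deriv

/-- A nonzero root of `X M(X²)` has at most the multiplicity of its square as a root of `M`. -/
theorem rootMultiplicity_X_mul_comp_sq {M : Polynomial ℝ} (hM : M ≠ 0) {r : ℝ} (hr : 0 < r) :
    (Polynomial.X * M.comp (Polynomial.X ^ 2)).rootMultiplicity r ≤ M.rootMultiplicity (r ^ 2) := by
  obtain ⟨L, hL, hL'⟩ := Polynomial.exists_eq_pow_rootMultiplicity_mul_and_not_dvd M hM (r ^ 2)
  set μ := M.rootMultiplicity (r ^ 2)
  have hroot : ¬ L.IsRoot (r ^ 2) := fun h => hL' (Polynomial.dvd_iff_isRoot.2 h)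
  -- X² - r² = (X - r)(X + r), and at r > 0 neither X nor X + r vanishes, so only the factor X - r
  -- carries multiplicity.
  have e : Polynomial.X * M.comp (Polynomial.X ^ 2) = (Polynomial.X - Polynomial.C r) ^ μ *
      (Polynomial.X * (Polynomial.X + Polynomial.C r) ^ μ * L.comp (Polynomial.X ^ 2)) := by
    rw [hL, Polynomial.mul_comp, Polynomial.pow_comp, Polynomial.sub_comp, Polynomial.X_comp,
      Polynomial.C_comp, Polynomial.C_pow, sq_sub_sq, mul_pow]
    ring
  have hne : (Polynomial.X * (Polynomial.X + Polynomial.C r) ^ μ *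
      L.comp (Polynomial.X ^ 2)).eval r ≠ 0 := by
    simp only [Polynomial.eval_mul, Polynomial.eval_X, Polynomial.eval_pow, Polynomial.eval_add,
      Polynomial.eval_C, Polynomial.eval_comp]
    have : L.eval (r ^ 2) ≠ 0 := hroot
    positivity
  have hne' : Polynomial.X * (Polynomial.X + Polynomial.C r) ^ μ *
      L.comp (Polynomial.X ^ 2) ≠ 0 := by
    intro h; rw [h] at hne; simp at hne
  rw [e, Polynomial.rootMultiplicity_mul
    (mul_ne_zero (pow_ne_zero _ (Polynomial.X_sub_C_ne_zero r)) hne'),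
    Polynomial.rootMultiplicity_eq_zero (p := _ * L.comp _) hne,
    Polynomial.rootMultiplicity_X_sub_C_pow, add_zero]

/-- The multiplicity of a positive root `r` of `M(X²)` bounds the number of zeros near `r` of a
smooth perturbation of `a M(a²)`. -/
theorem card_le_rootMultiplicity {M : Polynomial ℝ} (hM : M ≠ 0) {r : ℝ} (hr : 0 < r) {p : ℕ}
    {D : ℝ × ℝ → ℝ} (hD : ContDiffAt ℝ p D (r, 0)) {κ : ℝ} (hκ : κ ≠ 0)
    (hD0 : ∀ᶠ a in 𝓝 r, D (a, 0) = κ * (a * M.eval (a ^ 2)))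
    (hz : ∀ δ > 0, ∃ ε, |ε| < δ ∧ ∃ z : Fin p → ℝ, StrictMono z ∧
      ∀ i, |z i - r| < δ ∧ D (z i, ε) = 0) :
    p ≤ M.rootMultiplicity (r ^ 2) := by
  refine le_trans ?_ (rootMultiplicity_X_mul_comp_sq hM hr)
  have hcomp : M.comp (Polynomial.X ^ 2) ≠ 0 := by
    intro h
    rcases Polynomial.comp_eq_zero_iff.1 h with h | ⟨-, h⟩
    · exact hM h
    · have := congrArg Polynomial.natDegree h
      simp at this
  have hW : Polynomial.X * M.comp (Polynomial.X ^ 2) ≠ 0 := mul_ne_zero Polynomial.X_ne_zero hcomp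
  rcases p with _ | p
  · exact Nat.zero_le _
  refine (Polynomial.lt_rootMultiplicity_iff_isRoot_iterate_derivative hW).2 fun j hj => ?_
  -- Keeping only j + 1 of the p zeros gives the vanishing of the j-th derivative, for every j < p.
  have h1 := iteratedDeriv_eq_zero_of_zeros r j (hD.of_le (by norm_cast; omega)) fun δ hδ => by
    obtain ⟨ε, hε, z, hz, hz'⟩ := hz δ hδ
    exact ⟨ε, hε, z ∘ Fin.castLE (by omega), hz.comp (Fin.strictMono_castLE _), fun i => hz' _⟩
  have h2 : (fun a => D (a, 0)) =ᶠ[𝓝 r] fun a =>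
      (Polynomial.C κ * (Polynomial.X * M.comp (Polynomial.X ^ 2))).eval a := by
    filter_upwards [hD0] with a ha
    simp [ha]
  rw [h2.iteratedDeriv_eq, iteratedDeriv_polynomial, Polynomial.iterate_derivative_C_mul]
    at h1
  simp only [Polynomial.eval_mul, Polynomial.eval_C] at h1
  exact (mul_eq_zero.1 h1).resolve_left hκ

/-! ### The polar equation as an equation in the Banach algebra of continuous functions of the
angle. -/

/-- The radial component of the field `(P, Q)` at the point with coordinates
`x = a r cos θ`, `y = b r sin θ`. -/
def radialPart (α β c : ℝ) (P Q : Poly) (r θ : ℝ) : ℝ :=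
  val P (semiX α β * (r * Real.cos θ)) (semiY α * (r * Real.sin θ))
      (c ^ 2 - ((semiX α β * (r * Real.cos θ)) ^ 2 + (semiY α * (r * Real.sin θ)) ^ 2)) *
      (Real.cos θ / semiX α β) +
    val Q (semiX α β * (r * Real.cos θ)) (semiY α * (r * Real.sin θ))
      (c ^ 2 - ((semiX α β * (r * Real.cos θ)) ^ 2 + (semiY α * (r * Real.sin θ)) ^ 2)) *
      (Real.sin θ / semiY α)

/-- The angular component of the field `(P, Q)` at the point with coordinates
`x = a r cos θ`, `y = b r sin θ`. -/
def angularPart (α β c : ℝ) (P Q : Poly) (r θ : ℝ) : ℝ :=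
  val Q (semiX α β * (r * Real.cos θ)) (semiY α * (r * Real.sin θ))
      (c ^ 2 - ((semiX α β * (r * Real.cos θ)) ^ 2 + (semiY α * (r * Real.sin θ)) ^ 2)) *
      (Real.cos θ / semiY α) -
    val P (semiX α β * (r * Real.cos θ)) (semiY α * (r * Real.sin θ))
      (c ^ 2 - ((semiX α β * (r * Real.cos θ)) ^ 2 + (semiY α * (r * Real.sin θ)) ^ 2)) *
      (Real.sin θ / semiX α β)

/-- The right-hand side of the equation `dr/dθ = ε polarSlope` of the orbits. -/
def polarSlope (α β c : ℝ) (P Q : Poly) (ε r θ : ℝ) : ℝ :=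
  r * radialPart α β c P Q r θ / (freq α β * r + ε * angularPart α β c P Q r θ)

theorem radialIntegral_eq (α β c : ℝ) (P Q : Poly) (r : ℝ) :
    radialIntegral α β c P Q r = ∫ θ in (0 : ℝ)..(2 * Real.pi), radialPart α β c P Q r θ := rfl

theorem continuous_angularPart (α β c : ℝ) (P Q : Poly) :
    Continuous fun v : ℝ × ℝ => angularPart α β c P Q v.1 v.2 := by
  unfold angularPart
  refine ((continuous_val Q ?_ ?_ ?_).mul ?_).sub ((continuous_val P ?_ ?_ ?_).mul ?_) <;> fun_prop

/-- The space of continuous functions of the angle. -/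
abbrev AngleFun : Type := C(Set.Icc (0 : ℝ) (2 * Real.pi), ℝ)

theorem two_pi_nonneg : (0 : ℝ) ≤ 2 * Real.pi := by positivity

/-- The Volterra operator `ρ ↦ ∫₀ ρ`. -/
def volterra : AngleFun →L[ℝ] AngleFun :=
  LinearMap.mkContinuous
    { toFun := fun ρ =>
        ⟨fun θ => ∫ s in (0 : ℝ)..θ, ρ (Set.projIcc 0 (2 * Real.pi) two_pi_nonneg s), by
          have h : Continuous fun s => ρ (Set.projIcc 0 (2 * Real.pi) two_pi_nonneg s) := by
            fun_prop
          exact (intervalIntegral.continuous_primitive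
            (fun _ _ => h.intervalIntegrable _ _) 0).comp continuous_subtype_val⟩
      map_add' := fun ρ σ => by
        ext θ
        have h : ∀ τ : AngleFun, IntervalIntegrable
            (fun s => τ (Set.projIcc 0 (2 * Real.pi) two_pi_nonneg s)) MeasureTheory.volume 0 θ :=
          fun τ => Continuous.intervalIntegrable (by fun_prop) _ _
        exact intervalIntegral.integral_add (h ρ) (h σ)
      map_smul' := fun a ρ => by
        ext θ
        exact intervalIntegral.integral_smul a _ }
    (2 * Real.pi) fun ρ => by
      rw [ContinuousMap.norm_le _ (by positivity)]
      intro θ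
      refine (intervalIntegral.norm_integral_le_of_norm_le_const
        (C := ‖ρ‖) fun s _ => ρ.norm_coe_le_norm _).trans ?_
      rw [sub_zero, abs_of_nonneg θ.2.1, mul_comm]
      exact mul_le_mul_of_nonneg_right θ.2.2 (norm_nonneg _)

theorem volterra_apply (ρ : AngleFun) (θ : Set.Icc (0 : ℝ) (2 * Real.pi)) :
    volterra ρ θ = ∫ s in (0 : ℝ)..θ, ρ (Set.projIcc 0 (2 * Real.pi) two_pi_nonneg s) := rfl

theorem volterra_apply_of_eq {ρ : AngleFun} {f : ℝ → ℝ} (h : ∀ s, ρ s = f s)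
    (θ : Set.Icc (0 : ℝ) (2 * Real.pi)) : volterra ρ θ = ∫ s in (0 : ℝ)..θ, f s := by
  rw [volterra_apply]
  refine intervalIntegral.integral_congr fun s hs => ?_
  rw [Set.uIcc_of_le θ.2.1] at hs
  have hs' : s ∈ Set.Icc (0 : ℝ) (2 * Real.pi) := ⟨hs.1, hs.2.trans θ.2.2⟩
  simp only [Set.projIcc_of_mem _ hs', h]

/-- Polynomials act smoothly on a commutative normed algebra. Taking `E = AngleFun` makes the
superposition operators smooth without any estimate. -/
theorem contDiff_aeval {X E : Type*} [NormedAddCommGroup X] [NormedSpace ℝ X] [NormedCommRing E]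
    [NormedAlgebra ℝ E] {n : WithTop ℕ∞} {f : Fin 3 → X → E} (hf : ∀ i, ContDiff ℝ n (f i))
    (P : Poly) : ContDiff ℝ n fun x => MvPolynomial.aeval (fun i => f i x) P := by
  induction P using MvPolynomial.induction_on with
  | C a => simpa using contDiff_const
  | add p q hp hq => simpa only [map_add] using hp.add hq
  | mul_X p i hp => simpa only [map_mul, MvPolynomial.aeval_X] using hp.mul (hf i)

/-- The cosine as an element of `AngleFun`. -/
def cosFun : AngleFun := ⟨fun θ => Real.cos θ, by fun_prop⟩

/-- The sine as an element of `AngleFun`. -/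
def sinFun : AngleFun := ⟨fun θ => Real.sin θ, by fun_prop⟩

/-- The superposition operator of a polynomial in polar coordinates. -/
def polarOp (α β c : ℝ) (P : Poly) (ρ : AngleFun) : AngleFun :=
  MvPolynomial.aeval (fun i => (![semiX α β • (ρ * cosFun), semiY α • (ρ * sinFun),
    algebraMap ℝ AngleFun (c ^ 2) -
      ((semiX α β • (ρ * cosFun)) ^ 2 + (semiY α • (ρ * sinFun)) ^ 2)] : Fin 3 → AngleFun) i) P

theorem polarOp_apply (α β c : ℝ) (P : Poly) (ρ : AngleFun) (θ : Set.Icc (0 : ℝ) (2 * Real.pi)) :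
    polarOp α β c P ρ θ =
      val P (semiX α β * (ρ θ * Real.cos θ)) (semiY α * (ρ θ * Real.sin θ))
        (c ^ 2 - ((semiX α β * (ρ θ * Real.cos θ)) ^ 2 +
          (semiY α * (ρ θ * Real.sin θ)) ^ 2)) := by
  unfold polarOp val
  induction P using MvPolynomial.induction_on with
  | C a => simp
  | add p q hp hq => rw [map_add, map_add, ContinuousMap.add_apply, hp, hq]
  | mul_X p i hp =>
    rw [map_mul, map_mul, ContinuousMap.mul_apply, hp, MvPolynomial.aeval_X, MvPolynomial.eval_X]
    fin_cases i <;> simp [cosFun, sinFun]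

theorem contDiff_polarOp (α β c : ℝ) (P : Poly) {n : WithTop ℕ∞} :
    ContDiff ℝ n (polarOp α β c P) := by
  have h1 : ContDiff ℝ n fun ρ : AngleFun => semiX α β • (ρ * cosFun) :=
    (contDiff_id.mul contDiff_const).const_smul _
  have h2 : ContDiff ℝ n fun ρ : AngleFun => semiY α • (ρ * sinFun) :=
    (contDiff_id.mul contDiff_const).const_smul _
  refine contDiff_aeval (fun i => ?_) P
  fin_cases i
  · exact h1
  · exact h2
  · exact contDiff_const.sub ((h1.pow 2).add (h2.pow 2))

/-- `radialPart` as an operator. -/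
def radialOp (α β c : ℝ) (P Q : Poly) (ρ : AngleFun) : AngleFun :=
  polarOp α β c P ρ * ((semiX α β)⁻¹ • cosFun) + polarOp α β c Q ρ * ((semiY α)⁻¹ • sinFun)

/-- `angularPart` as an operator. -/
def angularOp (α β c : ℝ) (P Q : Poly) (ρ : AngleFun) : AngleFun :=
  polarOp α β c Q ρ * ((semiY α)⁻¹ • cosFun) - polarOp α β c P ρ * ((semiX α β)⁻¹ • sinFun)

/-- The denominator of `polarSlope` as an operator. -/
def slopeDenom (α β c : ℝ) (P Q : Poly) (v : AngleFun × ℝ) : AngleFun :=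
  freq α β • v.1 + v.2 • angularOp α β c P Q v.1

/-- `polarSlope` as an operator. -/
def slopeOp (α β c : ℝ) (P Q : Poly) (v : AngleFun × ℝ) : AngleFun :=
  v.1 * radialOp α β c P Q v.1 * Ring.inverse (slopeDenom α β c P Q v)

theorem radialOp_apply (α β c : ℝ) (P Q : Poly) (ρ : AngleFun)
    (θ : Set.Icc (0 : ℝ) (2 * Real.pi)) :
    radialOp α β c P Q ρ θ = radialPart α β c P Q (ρ θ) θ := by
  simp [radialOp, radialPart, polarOp_apply, cosFun, sinFun, div_eq_inv_mul]
  ring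

theorem angularOp_apply (α β c : ℝ) (P Q : Poly) (ρ : AngleFun)
    (θ : Set.Icc (0 : ℝ) (2 * Real.pi)) :
    angularOp α β c P Q ρ θ = angularPart α β c P Q (ρ θ) θ := by
  simp [angularOp, angularPart, polarOp_apply, cosFun, sinFun, div_eq_inv_mul]
  ring

theorem contDiff_radialOp (α β c : ℝ) (P Q : Poly) {n : WithTop ℕ∞} :
    ContDiff ℝ n (radialOp α β c P Q) :=
  ((contDiff_polarOp α β c P).mul contDiff_const).add
    ((contDiff_polarOp α β c Q).mul contDiff_const)

theorem contDiff_slopeDenom (α β c : ℝ) (P Q : Poly) {n : WithTop ℕ∞} :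
    ContDiff ℝ n (slopeDenom α β c P Q) := by
  have h : ContDiff ℝ n (angularOp α β c P Q) :=
    ((contDiff_polarOp α β c Q).mul contDiff_const).sub
      ((contDiff_polarOp α β c P).mul contDiff_const)
  exact (contDiff_fst.const_smul _).add (contDiff_snd.smul (h.comp contDiff_fst))

/-- `Ring.inverse` takes the default value 0 off the units, so the operator is the pointwise
quotient only where the denominator is a unit, that is, nowhere zero on the closed interval. -/
theorem slopeOp_apply {α β c : ℝ} {P Q : Poly} {v : AngleFun × ℝ}
    (hv : IsUnit (slopeDenom α β c P Q v)) (θ : Set.Icc (0 : ℝ) (2 * Real.pi)) :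
    slopeOp α β c P Q v θ = polarSlope α β c P Q v.2 (v.1 θ) θ := by
  have h := DFunLike.congr_fun (Ring.inverse_mul_cancel _ hv) θ
  have hd : slopeDenom α β c P Q v θ =
      freq α β * v.1 θ + v.2 * angularPart α β c P Q (v.1 θ) θ := by
    simp [slopeDenom, angularOp_apply]
  rw [ContinuousMap.mul_apply, ContinuousMap.one_apply] at h
  have hne : slopeDenom α β c P Q v θ ≠ 0 := right_ne_zero_of_mul_eq_one h
  unfold slopeOp polarSlope
  rw [ContinuousMap.mul_apply, ContinuousMap.mul_apply, radialOp_apply, ← hd, div_eq_mul_inv,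
    eq_inv_of_mul_eq_one_left h]

/-- The constant functions. -/
def constFun (a : ℝ) : AngleFun := algebraMap ℝ AngleFun a

theorem constFun_apply (a : ℝ) (θ : Set.Icc (0 : ℝ) (2 * Real.pi)) : constFun a θ = a := rfl

/-- At ε = 0 the denominator along a circle is a nonzero constant. Units form an open set, so this
one point provides a neighbourhood in which the division is legitimate. -/
theorem isUnit_slopeDenom_const {α β : ℝ} (hαβ : α * β < 0) (c : ℝ) (P Q : Poly) {a : ℝ}
    (ha : a ≠ 0) : IsUnit (slopeDenom α β c P Q (constFun a, 0)) := by
  have : slopeDenom α β c P Q (constFun a, 0) = algebraMap ℝ AngleFun (freq α β * a) := by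
    ext θ
    simp [slopeDenom, constFun_apply]
  rw [this]
  exact (IsUnit.mk0 _ (mul_ne_zero (freq_ne hαβ) ha)).map _

theorem contDiffAt_slopeOp {α β c : ℝ} {P Q : Poly} {v : AngleFun × ℝ}
    (hv : IsUnit (slopeDenom α β c P Q v)) {n : WithTop ℕ∞} :
    ContDiffAt ℝ n (slopeOp α β c P Q) v := by
  refine (contDiffAt_fst.mul ((contDiff_radialOp α β c P Q).contDiffAt.comp v contDiffAt_fst)).mul ?_
  obtain ⟨u, hu⟩ := hv
  have := contDiffAt_ringInverse (n := n) ℝ u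
  rw [hu] at this
  exact this.comp v (contDiff_slopeDenom α β c P Q).contDiffAt

/-! ### The displacement function, by the implicit function theorem. -/

/-- The equation `ρ = a + ε ∫₀ polarSlope` for the solutions of the polar equation can be solved for
`ρ` near the constants. -/
theorem exists_solution_operator {E : Type*} [NormedAddCommGroup E] [NormedSpace ℝ E]
    [CompleteSpace E] (V : E →L[ℝ] E) (ι : ℝ →L[ℝ] E) {F : E × ℝ → E} {r : ℝ} {n : ℕ}
    (hn : n ≠ 0) (hF : ContDiffAt ℝ n F (ι r, 0)) :
    ∃ R : ℝ × ℝ → E, ContDiffAt ℝ n R (r, 0) ∧ R (r, 0) = ι r ∧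
      ∀ᶠ v in 𝓝 ((r, (0 : ℝ)), ι r), v.2 = ι v.1.1 + v.1.2 • V (F (v.2, v.1.2)) → v.2 = R v.1 := by
  let G : (ℝ × ℝ) × E → E := fun v => v.2 - ι v.1.1 - v.1.2 • V (F (v.2, v.1.2))
  have hG : ContDiffAt ℝ n G ((r, 0), ι r) := by
    have h1 : ContDiffAt ℝ n (fun v : (ℝ × ℝ) × E => F (v.2, v.1.2)) ((r, 0), ι r) :=
      ContDiffAt.comp ((r, (0 : ℝ)), ι r) (g := F) (f := fun v : (ℝ × ℝ) × E => (v.2, v.1.2)) hF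
        (by fun_prop)
    exact ContDiffAt.sub (by fun_prop) (ContDiffAt.smul (by fun_prop) (V.contDiff.contDiffAt.comp _ h1))
  have hn' : (n : WithTop ℕ∞) ≠ 0 := by exact_mod_cast hn
  have hd := hG.differentiableAt hn'
  -- At ε = 0 the nonlinear term disappears and G is ρ - ι a, so its partial derivative in ρ is the
  -- identity.
  have hinv : fderiv ℝ G ((r, 0), ι r) ∘L .inr ℝ (ℝ × ℝ) E = ContinuousLinearMap.id ℝ E := by
    have h1 : HasFDerivAt (fun e : E => G ((r, 0), e))
        (fderiv ℝ G ((r, 0), ι r) ∘L .inr ℝ (ℝ × ℝ) E) (ι r) :=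
      HasFDerivAt.comp (ι r) hd.hasFDerivAt (hasFDerivAt_prodMk_right _ _)
    have h2 : HasFDerivAt (fun e : E => G ((r, 0), e)) (ContinuousLinearMap.id ℝ E) (ι r) := by
      simpa [G] using (hasFDerivAt_id (𝕜 := ℝ) (ι r)).sub_const (ι r)
    exact h1.unique h2
  have hif : (fderiv ℝ G ((r, 0), ι r) ∘L .inr ℝ (ℝ × ℝ) E).IsInvertible := by
    rw [hinv]
    exact ContinuousLinearMap.isInvertible_equiv (f := ContinuousLinearEquiv.refl ℝ E)
  refine ⟨hG.implicitFunction hn' hif, hG.contDiffAt_implicitFunction hn' hif,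
    hG.implicitFunction_apply_self hn' hif, ?_⟩
  filter_upwards [hG.eventually_apply_eq_iff_implicitFunction hn' hif] with v hv h
  refine (hv.1 ?_).symm
  have h0 : G ((r, 0), ι r) = 0 := by simp [G]
  rw [h0]
  simp only [G]
  rw [sub_sub, ← h, sub_self]

/-- The angle `2π` as a point of the interval. -/
def fullTurn : Set.Icc (0 : ℝ) (2 * Real.pi) := ⟨2 * Real.pi, two_pi_nonneg, le_rfl⟩

/-- Near the circle of radius `r > 0` the solutions of the polar equation over one turn are given by
a smooth solution operator, and their increments by a smooth displacement function. -/
theorem exists_displacement {α β : ℝ} (hαβ : α * β < 0) (c : ℝ) (P Q : Poly) {r : ℝ} (hr : 0 < r)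
    {n : ℕ} (hn : n ≠ 0) :
    ∃ (D : ℝ × ℝ → ℝ) (R : ℝ × ℝ → AngleFun), ContDiffAt ℝ n D (r, 0) ∧
      (∀ᶠ a in 𝓝 r, D (a, 0) = radialIntegral α β c P Q a / freq α β) ∧
      ∃ δ > 0, ∀ (ε : ℝ) (ρ : ℝ → ℝ), |ε| < δ →
        (∀ θ ∈ Set.Icc 0 (2 * Real.pi), |ρ θ - r| < δ) →
        (∀ θ ∈ Set.Icc 0 (2 * Real.pi),
          HasDerivAt ρ (ε * polarSlope α β c P Q ε (ρ θ) θ) θ) →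
        ρ (2 * Real.pi) = ρ 0 + ε * D (ρ 0, ε) ∧
          ∀ θ : Set.Icc (0 : ℝ) (2 * Real.pi), ρ θ = R (ρ 0, ε) θ := by
  set ι : ℝ →L[ℝ] AngleFun := Algebra.linearMap ℝ AngleFun |>.toContinuousLinearMap
  have hι : ∀ a, ι a = constFun a := fun a => rfl
  have hu0 := isUnit_slopeDenom_const hαβ c P Q hr.ne'
  obtain ⟨R, hR, hR0, hRev⟩ := exists_solution_operator volterra ι (F := slopeOp α β c P Q) (r := r)
    hn (contDiffAt_slopeOp hu0)
  have hunit : ∀ᶠ v in 𝓝 ((r, (0 : ℝ)), ι r),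
      IsUnit (slopeDenom α β c P Q (v.2, v.1.2)) := by
    have hcont : Continuous fun v : (ℝ × ℝ) × AngleFun => slopeDenom α β c P Q (v.2, v.1.2) :=
      (contDiff_slopeDenom α β c P Q (n := 0)).continuous.comp (by fun_prop)
    have hu1 : IsUnit (slopeDenom α β c P Q (ι r, 0)) := hu0
    exact (Units.isOpen.preimage hcont).mem_nhds (show ((r, (0 : ℝ)), ι r) ∈ _ from hu1)
  obtain ⟨δ, hδ, hall⟩ := Metric.eventually_nhds_iff.1 (hRev.and hunit)
  have near : ∀ {a ε : ℝ} {ρ : AngleFun}, |a - r| < δ → |ε| < δ → (∀ θ, |ρ θ - r| < δ) →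
      dist ((a, ε), ρ) ((r, (0 : ℝ)), ι r) < δ := by
    intro a ε ρ ha hε hρ
    rw [Prod.dist_eq, Prod.dist_eq]
    refine max_lt (max_lt (by simpa [Real.dist_eq] using ha) (by simpa [Real.dist_eq] using hε)) ?_
    rw [ContinuousMap.dist_lt_iff hδ]
    intro θ
    rw [hι, constFun_apply, Real.dist_eq]
    exact hρ θ
  -- D is the increment over a turn already divided by ε: the integral of the slope along the
  -- solution R. In this form it is smooth also at ε = 0.
  refine ⟨fun v => volterra (slopeOp α β c P Q (R v, v.2)) fullTurn, R, ?_, ?_, δ, hδ, ?_⟩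
  · have h1 : ContDiffAt ℝ n (fun v : ℝ × ℝ => slopeOp α β c P Q (R v, v.2)) (r, 0) := by
      refine ContDiffAt.comp (r, (0 : ℝ)) (g := slopeOp α β c P Q) (f := fun v => (R v, v.2)) ?_
        (hR.prodMk contDiffAt_snd)
      rw [hR0]
      exact contDiffAt_slopeOp hu0
    exact ((ContinuousMap.evalCLM ℝ fullTurn).comp volterra).contDiff.contDiffAt.comp _ h1
  · filter_upwards [Metric.ball_mem_nhds r hδ, lt_mem_nhds hr] with a ha ha0
    rw [Metric.mem_ball, Real.dist_eq] at ha
    obtain ⟨h1, h2⟩ := hall (near (a := a) (ε := 0) (ρ := constFun a) ha (by simpa) fun _ => ha)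
    -- For ε = 0 the circles are solutions, so R(a, 0) is the constant a.
    have h3 : constFun a = R (a, 0) := h1 (by simp [hι])
    have h4 : ∀ s : Set.Icc (0 : ℝ) (2 * Real.pi), slopeOp α β c P Q (R (a, 0), 0) s =
        radialPart α β c P Q a s / freq α β := by
      intro s
      rw [← h3, slopeOp_apply h2, constFun_apply, polarSlope, zero_mul, add_zero]
      have := freq_ne hαβ
      field_simp
    rw [radialIntegral_eq, ← intervalIntegral.integral_div]
    exact volterra_apply_of_eq (f := fun s => radialPart α β c P Q a s / freq α β) h4 fullTurn
  · intro ε ρ hε hρ hd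
    let σ : AngleFun := ⟨fun θ => ρ θ, continuous_iff_continuousAt.2 fun θ =>
      (hd θ θ.2).continuousAt.comp continuous_subtype_val.continuousAt⟩
    have hσ : ∀ θ, σ θ = ρ θ := fun _ => rfl
    obtain ⟨h1, h2⟩ := hall (near (a := ρ 0) (ε := ε) (ρ := σ) (hρ 0 ⟨le_rfl, two_pi_nonneg⟩) hε
      fun θ => hρ θ θ.2)
    have h4 : ∀ s : Set.Icc (0 : ℝ) (2 * Real.pi), slopeOp α β c P Q (σ, ε) s =
        polarSlope α β c P Q ε (ρ s) s := fun s => slopeOp_apply h2 s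
    -- Continuity of the slope along ρ is read off from its being an element of `AngleFun`.
    have hcont : ContinuousOn (fun s => polarSlope α β c P Q ε (ρ s) s)
        (Set.Icc 0 (2 * Real.pi)) := by
      rw [continuousOn_iff_continuous_domRestrict]
      refine (slopeOp α β c P Q (σ, ε)).continuous.congr h4
    have hint : ∀ θ : Set.Icc (0 : ℝ) (2 * Real.pi),
        ρ θ = ρ 0 + ε * volterra (slopeOp α β c P Q (σ, ε)) θ := by
      intro θ
      have hsub : Set.uIcc (0 : ℝ) θ ⊆ Set.Icc 0 (2 * Real.pi) := by
        rw [Set.uIcc_of_le θ.2.1]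
        exact Set.Icc_subset_Icc_right θ.2.2
      rw [volterra_apply_of_eq (f := fun s => polarSlope α β c P Q ε (ρ s) s) h4,
        ← intervalIntegral.integral_const_mul,
        intervalIntegral.integral_eq_sub_of_hasDerivAt (fun s hs => hd s (hsub hs))
          (((hcont.mono hsub).intervalIntegrable).const_mul ε)]
      ring
    have h5 : σ = R (ρ 0, ε) := h1 (by
      ext θ
      simpa [hι, constFun_apply, hσ] using hint θ)
    refine ⟨?_, fun θ => by rw [← h5, hσ]⟩
    have := hint fullTurn
    rw [h5] at this
    exact this

/-! ### Returning after several turns forces returning after one. -/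

/-- A periodic point of a strictly monotone displacement is a fixed point: if `ρ` advances by a
strictly monotone function and returns after `k > 0` turns, it returns after each of them. -/
theorem eq_of_strictMonoOn_of_return {s : Set ℝ} {π : ℝ → ℝ} (hπ : StrictMonoOn π s) {a : ℤ → ℝ}
    (ha : ∀ j, a j ∈ s) (hstep : ∀ j, a (j + 1) = π (a j)) {k : ℕ} (hk : 0 < k) (hret : a k = a 0) :
    ∀ j, a j = a 0 := by
  have h1 : a 1 = a 0 := by
    rcases lt_trichotomy (a 0) (a 1) with h | h | h
    · have hm : StrictMono fun j : ℕ => a j := strictMono_nat_of_lt_succ fun j => by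
        induction j with
        | zero => exact h
        | succ j ih =>
          push_cast at ih ⊢
          rw [hstep j, hstep (j + 1)]
          exact hπ (ha _) (ha _) ih
      exact absurd hret (hm hk).ne'
    · exact h.symm
    · have hm : StrictAnti fun j : ℕ => a j := strictAnti_nat_of_succ_lt fun j => by
        induction j with
        | zero => exact h
        | succ j ih =>
          push_cast at ih ⊢
          rw [hstep j, hstep (j + 1)]
          exact hπ (ha _) (ha _) ih
      exact absurd hret (hm hk).ne
  have h0 : π (a 0) = a 0 := by rw [← hstep, zero_add, h1]
  intro j
  induction j using Int.induction_on with
  | zero => rfl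
  | succ j ih => rw [hstep, ih, h0]
  -- Earlier turns need injectivity of the return map, not only the recursion.
  | pred j ih =>
    refine hπ.injOn (ha _) (ha _) ?_
    rw [← hstep, sub_add_cancel, ih, h0]

theorem radialPart_add_int_mul (α β c : ℝ) (P Q : Poly) (r θ : ℝ) (k : ℤ) :
    radialPart α β c P Q r (θ + k * (2 * Real.pi)) = radialPart α β c P Q r θ := by
  simp only [radialPart, Real.cos_add_int_mul_two_pi, Real.sin_add_int_mul_two_pi]

theorem angularPart_add_int_mul (α β c : ℝ) (P Q : Poly) (r θ : ℝ) (k : ℤ) :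
    angularPart α β c P Q r (θ + k * (2 * Real.pi)) = angularPart α β c P Q r θ := by
  simp only [angularPart, Real.cos_add_int_mul_two_pi, Real.sin_add_int_mul_two_pi]

theorem polarSlope_add_int_mul (α β c : ℝ) (P Q : Poly) (ε r θ : ℝ) (k : ℤ) :
    polarSlope α β c P Q ε r (θ + k * (2 * Real.pi)) = polarSlope α β c P Q ε r θ := by
  simp only [polarSlope, radialPart_add_int_mul, angularPart_add_int_mul]

/-- Near the circle of radius `r > 0`, solutions of the polar equation that return after some number
of turns are periodic; they are given by a smooth solution operator and correspond to zeros of a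
smooth displacement function. -/
theorem exists_displacement_of_return {α β : ℝ} (hαβ : α * β < 0) (c : ℝ) (P Q : Poly) {r : ℝ}
    (hr : 0 < r) {n : ℕ} (hn : n ≠ 0) :
    ∃ (D : ℝ × ℝ → ℝ) (R : ℝ × ℝ → AngleFun), ContDiffAt ℝ n D (r, 0) ∧
      (∀ᶠ a in 𝓝 r, D (a, 0) = radialIntegral α β c P Q a / freq α β) ∧
      ∃ δ > 0, ∀ (ε : ℝ) (ρ : ℝ → ℝ), ε ≠ 0 → |ε| < δ → (∀ θ, |ρ θ - r| < δ) →
        (∀ θ, HasDerivAt ρ (ε * polarSlope α β c P Q ε (ρ θ) θ) θ) →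
        (∃ k : ℕ, 0 < k ∧ ρ (k * (2 * Real.pi)) = ρ 0) →
        D (ρ 0, ε) = 0 ∧ ∀ (k : ℤ) (θ : Set.Icc (0 : ℝ) (2 * Real.pi)),
          ρ (θ + k * (2 * Real.pi)) = R (ρ 0, ε) θ := by
  obtain ⟨D, R, hD, hD0, δ, hδ, h⟩ := exists_displacement hαβ c P Q hr hn
  refine ⟨D, R, hD, hD0, ?_⟩
  obtain ⟨K, t, ht, hK⟩ := (hD.of_le (m := 1)
    (by exact_mod_cast Nat.one_le_iff_ne_zero.2 hn)).exists_lipschitzOnWith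
  obtain ⟨δ', hδ', hsub⟩ := Metric.mem_nhds_iff.1 ht
  -- The bound 1 / (K + 1) gives |ε|K < 1, where K is a Lipschitz constant of D; hence a ↦ a + εD(a,
  -- ε) is strictly increasing.
  refine ⟨min (min δ δ') (1 / (K + 1)), by positivity, ?_⟩
  intro ε ρ hε0 hε hρ hd ⟨k, hk, hret⟩
  have hε1 : |ε| < δ := hε.trans_le ((min_le_left _ _).trans (min_le_left _ _))
  have hε2 : |ε| < δ' := hε.trans_le ((min_le_left _ _).trans (min_le_right _ _))
  have hε3 : |ε| * (K + 1) < 1 := by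
    have := hε.trans_le (min_le_right _ _)
    rwa [lt_div_iff₀ (by positivity)] at this
  have hρ1 : ∀ θ, |ρ θ - r| < δ :=
    fun θ => (hρ θ).trans_le ((min_le_left _ _).trans (min_le_left _ _))
  have hρ2 : ∀ θ, |ρ θ - r| < δ' :=
    fun θ => (hρ θ).trans_le ((min_le_left _ _).trans (min_le_right _ _))
  have hmono : StrictMonoOn (fun a => a + ε * D (a, ε)) {a | |a - r| < δ'} := by
    intro a ha b hb hab
    have mem : ∀ a ∈ {a | |a - r| < δ'}, (a, ε) ∈ t := fun a ha => hsub (by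
      rw [Metric.mem_ball, Prod.dist_eq]
      exact max_lt (by simpa [Real.dist_eq] using ha) (by simpa [Real.dist_eq] using hε2))
    have h1 := hK.dist_le_mul _ (mem a ha) _ (mem b hb)
    rw [Prod.dist_eq, dist_self, max_eq_left dist_nonneg, Real.dist_eq, Real.dist_eq, abs_sub_comm a,
      abs_of_pos (sub_pos.2 hab)] at h1
    have h2 : |ε * (D (a, ε) - D (b, ε))| ≤ |ε| * (K * (b - a)) := by
      rw [abs_mul]
      exact mul_le_mul_of_nonneg_left h1 (abs_nonneg _)
    have h3 := (abs_le.1 h2).2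
    have h4 : |ε| * (K + 1) * (b - a) < 1 * (b - a) :=
      mul_lt_mul_of_pos_right hε3 (sub_pos.2 hab)
    have h5 : 0 ≤ |ε| * (b - a) := mul_nonneg (abs_nonneg _) (sub_pos.2 hab).le
    simp only
    nlinarith
  -- The polar equation is 2π-periodic in θ, so each full turn, shifted back to [0, 2π], is again a
  -- solution to which the solution operator applies.
  have shift : ∀ j : ℤ, ρ ((j + 1 : ℤ) * (2 * Real.pi)) =
      ρ (j * (2 * Real.pi)) + ε * D (ρ (j * (2 * Real.pi)), ε) ∧
      ∀ θ : Set.Icc (0 : ℝ) (2 * Real.pi),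
        ρ (θ + j * (2 * Real.pi)) = R (ρ (j * (2 * Real.pi)), ε) θ := by
    intro j
    have := h ε (fun θ => ρ (θ + j * (2 * Real.pi))) hε1 (fun θ _ => hρ1 _) fun θ _ => by
      have h1 := (hd (θ + j * (2 * Real.pi))).comp_add_const θ (j * (2 * Real.pi))
      have h2 := polarSlope_add_int_mul α β c P Q ε (ρ (θ + j * (2 * Real.pi))) θ j
      rwa [h2] at h1
    simp only [zero_add] at this
    refine ⟨?_, this.2⟩
    rw [← this.1]
    congr 1
    push_cast
    ring
  have hall := eq_of_strictMonoOn_of_return hmono (a := fun j : ℤ => ρ (j * (2 * Real.pi)))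
    (fun j => hρ2 _) (fun j => (shift j).1) hk (by simpa using hret)
  simp only [Int.cast_zero, zero_mul] at hall
  refine ⟨?_, fun k θ => by rw [(shift k).2, hall]⟩
  have h0 := (shift 0).1
  rw [hall, hall] at h0
  have : ε * D (ρ 0, ε) = 0 := by linarith
  exact (mul_eq_zero.1 this).resolve_left hε0

/-! ### From periodic orbits in space to returning solutions of the polar equation. -/

/-- A function whose derivative is bounded below by a positive constant has a differentiable
inverse, defined on the whole line. -/
theorem exists_inverse_of_le_deriv {f G : ℝ → ℝ} (hf : ∀ t, HasDerivAt f (G t) t) {δ : ℝ}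
    (hδ : 0 < δ) (hG : ∀ t, δ ≤ G t) :
    StrictMono f ∧ ∃ τ : ℝ ≃o ℝ, (∀ s, f (τ s) = s) ∧ (∀ t, τ (f t) = t) ∧
      ∀ s, HasDerivAt τ (G (τ s))⁻¹ s := by
  have hmono : StrictMono f := strictMono_of_hasDerivAt_pos hf fun t => hδ.trans_le (hG t)
  have hcont : Continuous f := continuous_iff_continuousAt.2 fun t => (hf t).continuousAt
  -- Comparison with the line δt makes f unbounded in both directions, hence onto.
  have hlin : Monotone fun t => f t - δ * t := by
    refine monotone_of_hasDerivAt_nonneg (f' := fun t => G t - δ * 1)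
      (fun t => (hf t).sub ((hasDerivAt_id t).const_mul δ)) fun t => ?_
    simpa using hG t
  have htop : Tendsto f atTop atTop := by
    refine tendsto_atTop_mono' _ ?_ (tendsto_atTop_add_const_left _ (f 0)
      (tendsto_id.const_mul_atTop hδ))
    filter_upwards [eventually_ge_atTop 0] with t ht
    have := hlin ht
    simp only [mul_zero, sub_zero] at this
    simp only [id]
    linarith
  have hbot : Tendsto f atBot atBot := by
    refine tendsto_atBot_mono' _ ?_ (tendsto_atBot_add_const_left _ (f 0)
      (tendsto_id.const_mul_atBot hδ))
    filter_upwards [eventually_le_atBot 0] with t ht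
    have := hlin ht
    simp only [mul_zero, sub_zero] at this
    simp only [id]
    linarith
  have hsurj : Function.Surjective f := hcont.surjective htop hbot
  let e := hmono.orderIsoOfSurjective f hsurj
  have h1 : ∀ s, f (e.symm s) = s := fun s => e.apply_symm_apply s
  refine ⟨hmono, e.symm, h1, fun t => e.symm_apply_apply t, fun s => ?_⟩
  exact HasDerivAt.of_local_left_inverse e.symm.continuous.continuousAt (hf _)
    (hδ.trans_le (hG _)).ne' (Eventually.of_forall h1)

theorem exists_polar_angle (u v : ℝ) :
    ∃ φ, u = √(u ^ 2 + v ^ 2) * Real.cos φ ∧ v = √(u ^ 2 + v ^ 2) * Real.sin φ := by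
  have h : ‖(⟨u, v⟩ : ℂ)‖ = √(u ^ 2 + v ^ 2) := by
    rw [Complex.norm_def, Complex.normSq_mk]
    ring_nf
  refine ⟨Complex.arg ⟨u, v⟩, ?_, ?_⟩
  · rw [← h, Complex.norm_mul_cos_arg]
  · rw [← h, Complex.norm_mul_sin_arg]

/-- The derivative of the distance to the origin along a plane curve. -/
theorem hasDerivAt_sqrt_sq_add_sq {u v : ℝ → ℝ} {du dv t : ℝ} (hu : HasDerivAt u du t)
    (hv : HasDerivAt v dv t) (hr : 0 < √(u t ^ 2 + v t ^ 2)) :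
    HasDerivAt (fun t => √(u t ^ 2 + v t ^ 2))
      ((u t * du + v t * dv) / √(u t ^ 2 + v t ^ 2)) t := by
  have h := ((hu.fun_pow 2).add (hv.fun_pow 2)).sqrt (Real.sqrt_pos.1 hr).ne'
  refine h.congr_deriv ?_
  simp only [Pi.add_apply]
  push_cast
  field_simp

/-- Every curve in the punctured plane has a continuous angle. -/
theorem exists_angle_lift {u v du dv : ℝ → ℝ} (hu : ∀ t, HasDerivAt u (du t) t)
    (hv : ∀ t, HasDerivAt v (dv t) t) (hdu : Continuous du) (hdv : Continuous dv)
    (hr : ∀ t, 0 < √(u t ^ 2 + v t ^ 2)) :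
    ∃ θ : ℝ → ℝ,
      (∀ t, HasDerivAt θ ((u t * dv t - v t * du t) / √(u t ^ 2 + v t ^ 2) ^ 2) t) ∧
      ∀ t, u t = √(u t ^ 2 + v t ^ 2) * Real.cos (θ t) ∧
        v t = √(u t ^ 2 + v t ^ 2) * Real.sin (θ t) := by
  have hcu : Continuous u := continuous_iff_continuousAt.2 fun t => (hu t).continuousAt
  have hcv : Continuous v := continuous_iff_continuousAt.2 fun t => (hv t).continuousAt
  have hG : Continuous fun t => (u t * dv t - v t * du t) / √(u t ^ 2 + v t ^ 2) ^ 2 :=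
    Continuous.div (by fun_prop) (by fun_prop) fun t => pow_ne_zero 2 (hr t).ne'
  obtain ⟨φ, hφ⟩ := exists_polar_angle (u 0) (v 0)
  set G := fun t => (u t * dv t - v t * du t) / √(u t ^ 2 + v t ^ 2) ^ 2 with hGdef
  -- The angle is defined by integrating the derivative it must have, starting from a polar angle of
  -- the initial point.
  have hθ : ∀ t, HasDerivAt (fun t => φ + ∫ s in (0 : ℝ)..t, G s) (G t) t := fun t =>
    (intervalIntegral.integral_hasDerivAt_right (hG.intervalIntegrable _ _)
      (hG.stronglyMeasurableAtFilter _ _) hG.continuousAt).const_add φ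
  set θ := fun t => φ + ∫ s in (0 : ℝ)..t, G s
  refine ⟨θ, hθ, ?_⟩
  set r := fun t => √(u t ^ 2 + v t ^ 2) with hrdef
  have hr' : ∀ t, 0 < r t := hr
  have hrsq : ∀ t, r t ^ 2 = u t ^ 2 + v t ^ 2 := fun t => Real.sq_sqrt (by positivity)
  have hrd : ∀ t, HasDerivAt r ((u t * du t + v t * dv t) / r t) t :=
    fun t => hasDerivAt_sqrt_sq_add_sq (hu t) (hv t) (hr t)
  have hξ : ∀ t, HasDerivAt (fun t => u t / r t) (-(G t * (v t / r t))) t := fun t => by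
    refine ((hu t).div (hrd t) (hr' t).ne').congr_deriv ?_
    have h0 := (hr' t).ne'
    have h1 := hrsq t
    change _ = -((u t * dv t - v t * du t) / r t ^ 2 * (v t / r t))
    field_simp
    rw [h1]
    ring
  have hζ : ∀ t, HasDerivAt (fun t => v t / r t) (G t * (u t / r t)) t := fun t => by
    refine ((hv t).div (hrd t) (hr' t).ne').congr_deriv ?_
    have h0 := (hr' t).ne'
    have h1 := hrsq t
    change _ = ((u t * dv t - v t * du t) / r t ^ 2 * (u t / r t))
    field_simp
    rw [h1]
    ring
  -- Both (u/r, v/r) and (cos θ, sin θ) rotate with angular velocity G, so their scalar and cross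
  -- products keep their initial values 1 and 0.
  have h1 : ∀ t, HasDerivAt
      (fun t => u t / r t * Real.cos (θ t) + v t / r t * Real.sin (θ t)) 0 t := fun t =>
    (((hξ t).mul (hθ t).cos).add ((hζ t).mul (hθ t).sin)).congr_deriv (by ring)
  have h2 : ∀ t, HasDerivAt
      (fun t => v t / r t * Real.cos (θ t) - u t / r t * Real.sin (θ t)) 0 t := fun t =>
    (((hζ t).mul (hθ t).cos).sub ((hξ t).mul (hθ t).sin)).congr_deriv (by ring)
  have hθ0 : θ 0 = φ := by simp [θ]
  have hcs := Real.sin_sq_add_cos_sq φ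
  have hu0 : u 0 = r 0 * Real.cos φ := hφ.1
  have hv0 : v 0 = r 0 * Real.sin φ := hφ.2
  intro t
  have e1 : u t / r t * Real.cos (θ t) + v t / r t * Real.sin (θ t) = 1 := by
    rw [is_const_of_deriv_eq_zero (fun t => (h1 t).differentiableAt) (fun t => (h1 t).deriv) t 0,
      hθ0, hu0, hv0]
    have h0 := (hr' 0).ne'
    field_simp
    linarith
  have e2 : v t / r t * Real.cos (θ t) - u t / r t * Real.sin (θ t) = 0 := by
    rw [is_const_of_deriv_eq_zero (fun t => (h2 t).differentiableAt) (fun t => (h2 t).deriv) t 0,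
      hθ0, hu0, hv0]
    have h0 := (hr' 0).ne'
    field_simp
    ring
  have hcs' := Real.sin_sq_add_cos_sq (θ t)
  have e3 : u t / r t = Real.cos (θ t) := by
    linear_combination Real.cos (θ t) * e1 - Real.sin (θ t) * e2 - u t / r t * hcs'
  have e4 : v t / r t = Real.sin (θ t) := by
    linear_combination Real.sin (θ t) * e1 + Real.cos (θ t) * e2 - v t / r t * hcs'
  have h0 := (hr' t).ne'
  change u t = r t * _ ∧ v t = r t * _
  rw [← e3, ← e4]
  constructor <;> field_simp

theorem eval_aeval_sq (P : Poly) (x y z : ℝ) :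
    MvPolynomial.eval ![x, y, z] (MvPolynomial.aeval
      ![MvPolynomial.X 0, MvPolynomial.X 1, (MvPolynomial.X 2 : Poly) ^ 2] P) =
      val P x y (z ^ 2) := by
  unfold val
  induction P using MvPolynomial.induction_on with
  | C a => simp
  | add p q hp hq => rw [map_add, map_add, hp, hq, map_add]
  | mul_X p i hp =>
    rw [map_mul, map_mul, hp, map_mul, MvPolynomial.aeval_X, MvPolynomial.eval_X]
    fin_cases i <;> simp

/-- The factor z matches the factor x₃ of the unperturbed first two equations. On the hemisphere the
projected motion is thus x₃ > 0 times a planar field, which only changes the time. -/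
theorem val_of_form {F S : Poly} (h : F = MvPolynomial.X 2 * MvPolynomial.aeval
      ![MvPolynomial.X 0, MvPolynomial.X 1, (MvPolynomial.X 2 : Poly) ^ 2] S) (x y z : ℝ) :
    val F x y z = z * val S x y (z ^ 2) := by
  rw [h, val, map_mul, eval_aeval_sq, MvPolynomial.eval_X]
  simp

/-- The radial coordinate. -/
def radius (α β : ℝ) (p : Space) : ℝ := √((p 0 / semiX α β) ^ 2 + (p 1 / semiY α) ^ 2)

/-- The point of the upper hemisphere with given polar coordinates. -/
def polarPoint (α β c r s : ℝ) : Space :=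
  !₂[semiX α β * (r * Real.cos s), semiY α * (r * Real.sin s),
    √(c ^ 2 - ((semiX α β * (r * Real.cos s)) ^ 2 + (semiY α * (r * Real.sin s)) ^ 2))]

/-- A periodic curve in the plane that follows the perturbed centre, with speed `w`, and winds around
the origin, is described by a solution of the polar equation that returns after some number of
turns. -/
theorem exists_polar_solution_of_plane {α β c ε : ℝ} (hαβ : α * β < 0) (P Q : Poly)
    {u v w p q : ℝ → ℝ}
    (hp : ∀ t, p t = val P (semiX α β * u t) (semiY α * v t)
      (c ^ 2 - ((semiX α β * u t) ^ 2 + (semiY α * v t) ^ 2)))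
    (hq : ∀ t, q t = val Q (semiX α β * u t) (semiY α * v t)
      (c ^ 2 - ((semiX α β * u t) ^ 2 + (semiY α * v t) ^ 2)))
    (hdu' : ∀ t, HasDerivAt u (w t * (-(freq α β) * v t + ε * (p t / semiX α β))) t)
    (hdv' : ∀ t, HasDerivAt v (w t * (freq α β * u t + ε * (q t / semiY α))) t)
    (hc2 : Continuous w) (hwpos : ∀ t, 0 < w t) {T : ℝ} (hT : 0 < T)
    (hpu : Function.Periodic u T) (hpv : Function.Periodic v T) (hpw : Function.Periodic w T)
    (hr : ∀ t, 0 < √(u t ^ 2 + v t ^ 2))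
    (hang : ∀ t θ, 0 < freq α β * (freq α β * √(u t ^ 2 + v t ^ 2) +
      ε * angularPart α β c P Q √(u t ^ 2 + v t ^ 2) θ)) :
    ∃ ρ θ τ : ℝ → ℝ, (∀ s, HasDerivAt ρ (ε * polarSlope α β c P Q ε (ρ s) s) s) ∧
      (∃ k : ℕ, 0 < k ∧ ρ (k * (2 * Real.pi)) = ρ 0) ∧
      (∀ s, ρ s = √(u (τ s) ^ 2 + v (τ s) ^ 2)) ∧ (∀ s, θ (τ s) = s) ∧ (∀ t, τ (θ t) = t) ∧
      ∀ t, u t = √(u t ^ 2 + v t ^ 2) * Real.cos (θ t) ∧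
        v t = √(u t ^ 2 + v t ^ 2) * Real.sin (θ t) := by
  have hX := (semiX_pos hαβ).ne'
  have hY := (semiY_pos hαβ).ne'
  have hω := freq_ne hαβ
  have hcu : Continuous u := continuous_iff_continuousAt.2 fun t => (hdu' t).continuousAt
  have hcv : Continuous v := continuous_iff_continuousAt.2 fun t => (hdv' t).continuousAt
  have hcp : Continuous p := by
    rw [funext hp]; exact continuous_val P (by fun_prop) (by fun_prop) (by fun_prop)
  have hcq : Continuous q := by
    rw [funext hq]; exact continuous_val Q (by fun_prop) (by fun_prop) (by fun_prop)
  obtain ⟨θ, hθ, hθuv⟩ := exists_angle_lift hdu' hdv' (by fun_prop) (by fun_prop) hr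
  obtain ⟨r, hrdef⟩ : ∃ r : ℝ → ℝ, ∀ t, √(u t ^ 2 + v t ^ 2) = r t := ⟨_, fun _ => rfl⟩
  have hcr : Continuous r := by rw [← funext hrdef]; fun_prop
  have hrd0 : ∀ t, HasDerivAt r _ t := fun t =>
    funext hrdef ▸ hasDerivAt_sqrt_sq_add_sq (hdu' t) (hdv' t) (hr t)
  simp only [hrdef] at hr hang hθ hθuv hrd0 ⊢
  have hur : ∀ t, u t = r t * Real.cos (θ t) := fun t => (hθuv t).1
  have hvr : ∀ t, v t = r t * Real.sin (θ t) := fun t => (hθuv t).2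
  have hcs : ∀ t, Real.sin (θ t) ^ 2 + Real.cos (θ t) ^ 2 = 1 := fun t => Real.sin_sq_add_cos_sq _
  have hrad : ∀ t, radialPart α β c P Q (r t) (θ t) =
      p t * (Real.cos (θ t) / semiX α β) + q t * (Real.sin (θ t) / semiY α) := fun t => by
    unfold radialPart
    rw [← hur, ← hvr, ← hp, ← hq]
  have hangl : ∀ t, angularPart α β c P Q (r t) (θ t) =
      q t * (Real.cos (θ t) / semiY α) - p t * (Real.sin (θ t) / semiX α β) := fun t => by
    unfold angularPart
    rw [← hur, ← hvr, ← hp, ← hq]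
  obtain ⟨G, hG⟩ : ∃ G : ℝ → ℝ, ∀ t, (u t * (w t * (freq α β * u t + ε * (q t / semiY α))) -
      v t * (w t * (-(freq α β) * v t + ε * (p t / semiX α β)))) / r t ^ 2 = G t :=
    ⟨_, fun _ => rfl⟩
  have hGeq : ∀ t, G t = w t * (freq α β * r t +
      ε * angularPart α β c P Q (r t) (θ t)) / r t := fun t => by
    have h0 := (hr t).ne'
    rw [hangl, ← hG, hur, hvr]
    field_simp
    linear_combination w t * freq α β * r t * semiX α β * semiY α * hcs t
  have hrd : ∀ t, HasDerivAt r (w t * (ε * radialPart α β c P Q (r t) (θ t))) t := fun t => by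
    refine (hrd0 t).congr_deriv ?_
    have h0 := (hr t).ne'
    rw [hrad, hur, hvr]
    field_simp
    ring
  have hGpos : ∀ t, 0 < freq α β * G t := fun t => by
    rw [hGeq, show freq α β * (w t * (freq α β * r t +
      ε * angularPart α β c P Q (r t) (θ t)) / r t) = w t * (freq α β * (freq α β * r t +
      ε * angularPart α β c P Q (r t) (θ t))) / r t by ring]
    exact div_pos (mul_pos (hwpos t) (hang t _)) (hr t)
  have hGcont : Continuous G := by
    rw [← funext hG]
    exact Continuous.div (by fun_prop) (by fun_prop) fun t => pow_ne_zero 2 (hr t).ne'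
  have hpr : Function.Periodic r T := fun t => by rw [← hrdef, ← hrdef, hpu, hpv]
  have hGper : Function.Periodic (fun t => freq α β * G t) T := fun t => by
    simp only [← hG, hp, hq, hpu t, hpv t, hpw t, hpr t]
  simp only [hG] at hθ
  -- Periodicity makes the range of the angular speed compact; its least value is the uniform
  -- positive lower bound needed to invert the angle.
  obtain ⟨δ, ⟨t₁, ht₁⟩, hδ⟩ := (hGper.compact_of_continuous hT.ne'
    (continuous_const.mul hGcont)).exists_isLeast (Set.range_nonempty _)
  -- What is inverted is `freq α β` times the angle, which increases for either sign of the
  -- frequency; this is why τ is evaluated at `freq α β * s` below.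
  obtain ⟨hmono, τ, hτ1, hτ2, hτd⟩ := exists_inverse_of_le_deriv
    (fun t => (hθ t).const_mul (freq α β)) (δ := δ) (ht₁ ▸ hGpos t₁)
    (fun t => hδ ⟨t, rfl⟩)
  have hθτ : ∀ s, θ (τ (freq α β * s)) = s := fun s => mul_left_cancel₀ hω (hτ1 _)
  refine ⟨fun s => r (τ (freq α β * s)), θ, fun s => τ (freq α β * s), fun s => ?_, ?_,
    fun s => rfl, hθτ, hτ2, hθuv⟩
  · have h1 : HasDerivAt (fun s => τ (freq α β * s)) (G (τ (freq α β * s)))⁻¹ s := by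
      have h2 : HasDerivAt (fun s => freq α β * s) (freq α β) s := by
        simpa using (hasDerivAt_id s).const_mul (freq α β)
      refine ((hτd (freq α β * s)).comp s h2).congr_deriv ?_
      have := right_ne_zero_of_mul (hGpos (τ (freq α β * s))).ne'
      field_simp
    refine ((hrd _).comp s h1).congr_deriv ?_
    rw [hGeq, hθτ]
    dsimp only
    generalize τ (freq α β * s) = t
    have h3 : freq α β * r t + ε * angularPart α β c P Q (r t) s ≠ 0 :=
      right_ne_zero_of_mul (hang t s).ne'
    have h0 := (hr t).ne'
    have h4 := (hwpos t).ne'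
    simp only [polarSlope]
    field_simp
  -- T' is T or -T, with the sign for which the angle increases. The point at t₀ + T' is the point
  -- at t₀, so the angle has grown by a positive multiple of 2π, which gives k.
  · obtain ⟨T', hT', hpu', hpr'⟩ : ∃ T', 0 < freq α β * T' ∧ Function.Periodic u T' ∧
        Function.Periodic r T' := by
      rcases lt_or_gt_of_ne hω with h | h
      · exact ⟨-T, mul_pos_of_neg_of_neg h (by linarith), hpu.neg, hpr.neg⟩
      · exact ⟨T, mul_pos h hT, hpu, hpr⟩
    obtain ⟨t₀, ht₀⟩ : ∃ t₀, τ (freq α β * 0) = t₀ := ⟨_, rfl⟩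
    have hθ0 : θ t₀ = 0 := by rw [← ht₀, hθτ]
    have hcos : Real.cos (θ (t₀ + T')) = 1 := by
      have := hur (t₀ + T')
      rw [hpr', hpu', hur, hθ0, Real.cos_zero] at this
      exact (mul_left_cancel₀ (hr t₀).ne' this).symm
    obtain ⟨k, hk⟩ := (Real.cos_eq_one_iff _).1 hcos
    have hkpos : 0 < (k : ℝ) * (2 * Real.pi) := by
      rw [hk]
      rcases lt_or_gt_of_ne hω with h | h
      · have := hmono (show t₀ + T' < t₀ by nlinarith)
        simp only [hθ0, mul_zero] at this
        nlinarith
      · have := hmono (show t₀ < t₀ + T' by nlinarith)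
        simp only [hθ0, mul_zero] at this
        nlinarith
    have hkpos' : 0 < k := by
      have := pos_of_mul_pos_left hkpos (by positivity)
      exact_mod_cast this
    refine ⟨k.toNat, by omega, ?_⟩
    have hcast : ((k.toNat : ℕ) : ℝ) = (k : ℝ) := by
      rw [← Int.cast_natCast, Int.toNat_of_nonneg hkpos'.le]
    simp only
    rw [hcast, hk, hτ2, hpr', ht₀]

/-- A periodic orbit in the upper hemisphere that winds around the axis is described by a solution
of the polar equation that returns after some number of turns. -/
theorem exists_polar_solution {α β γ c ε : ℝ} (hαβ : α * β < 0) {m : ℕ} {A B C P Q : Poly}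
    (hp : IsPerturbation m A B C P Q) {x : ℝ → Space} (hx : IsSolution α β γ ε A B C x) {T : ℝ}
    (hT : 0 < T) (hper : Function.Periodic x T) (hsph : ∀ t, x t ∈ upperHemisphere c)
    (hr : ∀ t, 0 < radius α β (x t))
    (hang : ∀ t θ, 0 < freq α β *
      (freq α β * radius α β (x t) + ε * angularPart α β c P Q (radius α β (x t)) θ)) :
    ∃ ρ : ℝ → ℝ, (∀ s, HasDerivAt ρ (ε * polarSlope α β c P Q ε (ρ s) s) s) ∧
      (∃ k : ℕ, 0 < k ∧ ρ (k * (2 * Real.pi)) = ρ 0) ∧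
      (∀ s, ∃ t, ρ s = radius α β (x t)) ∧
      Set.range x = Set.range fun s => polarPoint α β c (ρ s) s := by
  have hX := (semiX_pos hαβ).ne'
  have hY := (semiY_pos hαβ).ne'
  have hxu : ∀ t, x t 0 = semiX α β * (x t 0 / semiX α β) := fun t => by field_simp
  have hxv : ∀ t, x t 1 = semiY α * (x t 1 / semiY α) := fun t => by field_simp
  have hwsq : ∀ t, x t 2 ^ 2 = c ^ 2 - (x t 0 ^ 2 + x t 1 ^ 2) := fun t => by
    linarith [(hsph t).1]
  obtain ⟨ρ, θ, τ, hρ, hret, hρτ, hθτ, hτθ, huv⟩ := exists_polar_solution_of_plane (c := c) (ε := ε)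
    hαβ P Q (u := fun t => x t 0 / semiX α β) (v := fun t => x t 1 / semiY α) (w := fun t => x t 2)
    (p := fun t => val P (x t 0) (x t 1) (x t 2 ^ 2))
    (q := fun t => val Q (x t 0) (x t 1) (x t 2 ^ 2))
    (fun t => by rw [← hxu, ← hxv, hwsq]) (fun t => by rw [← hxu, ← hxv, hwsq])
    (fun t => by
      refine ((hx t).1.div_const (semiX α β)).congr_deriv ?_
      rw [val_of_form hp.formA]
      have := alpha_mul_semiY hαβ
      generalize val P (x t 0) (x t 1) (x t 2 ^ 2) = z
      field_simp
      linear_combination x t 1 * x t 2 * this)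
    (fun t => by
      refine ((hx t).2.1.div_const (semiY α)).congr_deriv ?_
      rw [val_of_form hp.formB]
      have := beta_mul_semiX hαβ
      generalize val Q (x t 0) (x t 1) (x t 2 ^ 2) = z
      field_simp
      linear_combination x t 0 * x t 2 * this)
    (continuous_iff_continuousAt.2 fun t => (hx t).2.2.continuousAt) (fun t => (hsph t).2) hT
    (fun t => by simp only [hper t]) (fun t => by simp only [hper t])
    (fun t => by simp only [hper t]) hr hang
  refine ⟨ρ, hρ, hret, fun s => ⟨τ s, hρτ s⟩, ?_⟩
  have hpt : ∀ t, x t = polarPoint α β c (radius α β (x t)) (θ t) := fun t => by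
    unfold polarPoint radius
    rw [← (huv t).1, ← (huv t).2, ← hxu, ← hxv, ← hwsq, Real.sqrt_sq (hsph t).2.le]
    ext i
    fin_cases i <;> simp
  ext z
  constructor
  · rintro ⟨t, rfl⟩
    refine ⟨θ t, ?_⟩
    simp only [hρτ, hτθ]
    exact (hpt t).symm
  · rintro ⟨s, rfl⟩
    refine ⟨τ s, ?_⟩
    refine (hpt (τ s)).trans ?_
    simp only [hρτ, hθτ]
    rfl

/-! ### Orbits near an oval and the upper bound. -/

theorem H_eq_radius_sq {α β : ℝ} (hαβ : α * β < 0) (p : Space) :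
    radius α β p ^ 2 = 2 * (α * ((α * p 1 ^ 2 - β * p 0 ^ 2) / 2)) := by
  have := alpha_ne hαβ
  have := beta_ne hαβ
  unfold radius
  rw [Real.sq_sqrt (by positivity), div_pow, div_pow, semiX_sq hαβ, semiY_sq]
  field_simp
  ring

theorem radius_eq_of_mem_oval {α β c h : ℝ} (hαβ : α * β < 0) {p : Space}
    (hp : p ∈ oval α β c h) : radius α β p = √(2 * (α * h)) := by
  rw [← Real.sqrt_sq (show 0 ≤ radius α β p from Real.sqrt_nonneg _), H_eq_radius_sq hαβ, hp.2]

/-- The radius is the norm of a linear map to ℂ. This converts Hausdorff closeness to an oval into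
closeness of the radial coordinate. -/
theorem lipschitzWith_radius {α β : ℝ} (hαβ : α * β < 0) :
    ∃ K : NNReal, LipschitzWith K (radius α β) := by
  let L : Space →L[ℝ] ℂ :=
    ((semiX α β)⁻¹ • EuclideanSpace.proj (0 : Fin 3)).smulRight (1 : ℂ) +
      ((semiY α)⁻¹ • EuclideanSpace.proj (1 : Fin 3)).smulRight Complex.I
  have h : ∀ p, radius α β p = ‖L p‖ := fun p => by
    have : L p = ⟨p 0 / semiX α β, p 1 / semiY α⟩ := by
      have hX := (semiX_pos hαβ).ne'
      have hY := (semiY_pos hαβ).ne'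
      apply Complex.ext <;> simp [L] <;> field_simp
    rw [this, Complex.norm_def, Complex.normSq_mk, radius]
    ring_nf
  refine ⟨1 * ‖L‖₊, ?_⟩
  rw [funext h]
  exact lipschitzWith_one_norm.comp L.lipschitz

/-- At ε = 0 the expression is ω²r > 0 for ω = `freq α β`; compactness and periodicity in θ make the
neighbourhood independent of the angle. It guarantees that orbits near the oval keep turning in one
direction. -/
theorem eventually_angular_speed_pos {α β : ℝ} (hαβ : α * β < 0) (c : ℝ) (P Q : Poly) {r : ℝ}
    (hr : 0 < r) :
    ∃ δ > 0, ∀ a ε θ, |a - r| < δ → |ε| < δ →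
      0 < freq α β * (freq α β * a + ε * angularPart α β c P Q a θ) := by
  have hcont : Continuous fun v : (ℝ × ℝ) × ℝ =>
      freq α β * (freq α β * v.1.1 + v.1.2 * angularPart α β c P Q v.1.1 v.2) := by
    have := (continuous_angularPart α β c P Q).comp
      (show Continuous fun v : (ℝ × ℝ) × ℝ => (v.1.1, v.2) by fun_prop)
    simp only [Function.comp_def] at this
    fun_prop
  have hev : ∀ᶠ v in 𝓝 (r, (0 : ℝ)), ∀ θ ∈ Set.Icc 0 (2 * Real.pi),
      0 < freq α β * (freq α β * v.1 + v.2 * angularPart α β c P Q v.1 θ) := by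
    refine isCompact_Icc.eventually_forall_of_forall_eventually fun θ _ => ?_
    refine continuousAt_const.eventually_lt hcont.continuousAt ?_
    have := freq_ne hαβ
    simp only [zero_mul, add_zero, ← mul_assoc]
    exact mul_pos (mul_self_pos.2 this) hr
  obtain ⟨δ, hδ, h⟩ := Metric.eventually_nhds_iff.1 hev
  refine ⟨δ, hδ, fun a ε θ ha hε => ?_⟩
  have hper : Function.Periodic (fun θ => angularPart α β c P Q a θ) (2 * Real.pi) := fun θ => by
    simpa using angularPart_add_int_mul α β c P Q a θ 1
  obtain ⟨θ', hθ', he⟩ := hper.exists_mem_Ico₀ Real.two_pi_pos θ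
  rw [he]
  refine h (y := (a, ε)) ?_ θ' (Set.Ico_subset_Icc_self hθ')
  rw [Prod.dist_eq]
  exact max_lt (by simpa [Real.dist_eq] using ha) (by simpa [Real.dist_eq] using hε)

theorem polarPoint_add_int_mul (α β c r s : ℝ) (k : ℤ) :
    polarPoint α β c r (s + k * (2 * Real.pi)) = polarPoint α β c r s := by
  simp only [polarPoint, Real.cos_add_int_mul_two_pi, Real.sin_add_int_mul_two_pi]

/-- Periodic orbits in the upper hemisphere near a fixed oval are determined by zeros of a smooth
displacement function. -/
theorem exists_displacement_of_oval {α β c h₀ : ℝ} (γ : ℝ) (hαβ : α * β < 0) (hh : 0 < α * h₀)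
    {m : ℕ} {A B C P Q : Poly} (hp : IsPerturbation m A B C P Q) {n : ℕ} (hn : n ≠ 0) :
    ∃ (D : ℝ × ℝ → ℝ) (S : ℝ → ℝ → Set Space),
      ContDiffAt ℝ n D (√(2 * (α * h₀)), 0) ∧
      (∀ᶠ a in 𝓝 √(2 * (α * h₀)), D (a, 0) = radialIntegral α β c P Q a / freq α β) ∧
      ∀ δ > 0, ∃ δ' > 0, ∀ (ε : ℝ) (Γ : Set Space), ε ≠ 0 → |ε| < δ' →
        IsPeriodicOrbit α β γ ε A B C Γ → Γ ⊆ upperHemisphere c →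
        Metric.hausdorffEDist Γ (oval α β c h₀) < ENNReal.ofReal δ' →
        ∃ a, |a - √(2 * (α * h₀))| < δ ∧ D (a, ε) = 0 ∧ Γ = S ε a := by
  set r := √(2 * (α * h₀)) with hrdef
  have hr : 0 < r := Real.sqrt_pos.2 (by positivity)
  obtain ⟨D, R, hD, hD0, δ₁, hδ₁, hret⟩ := exists_displacement_of_return hαβ c P Q hr hn
  obtain ⟨δ₂, hδ₂, hang⟩ := eventually_angular_speed_pos hαβ c P Q hr
  obtain ⟨K, hK⟩ := lipschitzWith_radius hαβ
  -- The set attached to (ε, a) is the curve drawn by the solution operator over one turn, so an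
  -- orbit can be recovered from its zero a of D.
  refine ⟨D, fun ε a => Set.range fun s : Set.Icc (0 : ℝ) (2 * Real.pi) =>
    polarPoint α β c (R (a, ε) s) s, hD, hD0, fun δ hδ => ?_⟩
  have hη : 0 < min (min δ r) (min δ₁ δ₂) := by positivity
  set η := min (min δ r) (min δ₁ δ₂) with hηdef
  -- A point within η / (K + 1) of the oval has radius within η of r, since the radius is
  -- K-Lipschitz and constant on the oval.
  refine ⟨min η (η / (K + 1)), by positivity, ?_⟩
  intro ε Γ hε0 hε hΓ hsub hdist
  have hε1 : |ε| < η := hε.trans_le (min_le_left _ _)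
  have hη1 : η ≤ δ := (min_le_left _ _).trans (min_le_left _ _)
  have hη2 : η ≤ r := (min_le_left _ _).trans (min_le_right _ _)
  have hη3 : η ≤ δ₁ := (min_le_right _ _).trans (min_le_left _ _)
  have hη4 : η ≤ δ₂ := (min_le_right _ _).trans (min_le_right _ _)
  obtain ⟨x, hx, ⟨T, hT, hper⟩, -, rfl⟩ := hΓ
  have hnear : ∀ t, |radius α β (x t) - r| < η := fun t => by
    obtain ⟨q, hq, hxq⟩ := Metric.exists_edist_lt_of_hausdorffEDist_lt (Set.mem_range_self t) hdist
    rw [edist_dist, ENNReal.ofReal_lt_ofReal_iff (by positivity)] at hxq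
    have h1 := hK.dist_le_mul (x t) q
    rw [radius_eq_of_mem_oval hαβ hq, Real.dist_eq] at h1
    have h2 := hxq.trans_le (min_le_right _ _)
    rw [lt_div_iff₀ (by positivity)] at h2
    have h3 : 0 ≤ dist (x t) q := dist_nonneg
    have h4 : (0 : ℝ) ≤ K := K.2
    nlinarith
  have hpos : ∀ t, 0 < radius α β (x t) := fun t => by
    have := (abs_lt.1 (hnear t)).1
    linarith
  obtain ⟨ρ, hρ, hk, hρx, hrange⟩ := exists_polar_solution hαβ hp hx hT hper
    (fun t => hsub ⟨t, rfl⟩) hpos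
    (fun t θ => hang _ _ _ ((hnear t).trans_le hη4) (hε1.trans_le hη4))
  have hρr : ∀ s, |ρ s - r| < η := fun s => by
    obtain ⟨t, ht⟩ := hρx s
    rw [ht]
    exact hnear t
  obtain ⟨hD, hR⟩ := hret ε ρ hε0 (hε1.trans_le hη3) (fun s => (hρr s).trans_le hη3) hρ hk
  refine ⟨ρ 0, (hρr 0).trans_le hη1, hD, ?_⟩
  obtain ⟨k, hk0, hk⟩ := hk
  have hR' : ∀ s : Set.Icc (0 : ℝ) (2 * Real.pi), ρ s = R (ρ 0, ε) s := fun s => by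
    simpa using hR 0 s
  rw [hrange]
  apply Set.Subset.antisymm
  · rintro _ ⟨s, rfl⟩
    obtain ⟨j, hj, -⟩ := existsUnique_add_zsmul_mem_Ico Real.two_pi_pos s 0
    rw [zero_add, zsmul_eq_mul] at hj
    refine ⟨⟨_, Set.Ico_subset_Icc_self hj⟩, ?_⟩
    have h1 := hR (-j) ⟨_, Set.Ico_subset_Icc_self hj⟩
    rw [show s + j * (2 * Real.pi) + ((-j : ℤ) : ℝ) * (2 * Real.pi) = s by push_cast; ring] at h1
    simp only [← h1, polarPoint_add_int_mul]
  · rintro _ ⟨s, rfl⟩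
    exact ⟨s, by simp only [hR']⟩

/-- The number of limit cycles that bifurcate from one oval is bounded by the multiplicity of the
corresponding root. -/
theorem card_le_rootMultiplicity_of_bifurcate {α β γ c : ℝ} (hαβ : α * β < 0) {m : ℕ}
    {A B C P Q : Poly} (hp : IsPerturbation m A B C P Q) {M : Polynomial ℝ} (hM0 : M ≠ 0)
    (hM : ∀ r : ℝ, r * radialIntegral α β c P Q r = r ^ 2 * M.eval (r ^ 2)) {l : Filter ℝ}
    [l.NeBot] (hl : l ≤ 𝓝[≠] (0 : ℝ)) {h₀ : ℝ} (hh : 0 < α * h₀) {ι : Type*} (S : Finset ι)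
    {Γ : ι → ℝ → Set Space}
    (hΓ : ∀ᶠ ε in l, (∀ i, IsPeriodicOrbit α β γ ε A B C (Γ i ε) ∧ Γ i ε ⊆ upperHemisphere c) ∧
      ∀ i j, i ≠ j → Γ i ε ≠ Γ j ε)
    (hlim : ∀ i ∈ S, Tendsto (fun ε => Metric.hausdorffEDist (Γ i ε) (oval α β c h₀)) l (𝓝 0)) :
    S.card ≤ M.rootMultiplicity (2 * (α * h₀)) := by
  rcases Nat.eq_zero_or_pos S.card with h0 | hpos
  · rw [h0]; exact Nat.zero_le _
  -- Smoothness of order `S.card` is what the Rolle argument consumes; it must be nonzero for the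
  -- implicit function theorem, hence the separate empty case.
  obtain ⟨D, Z, hD, hD0, hex⟩ := exists_displacement_of_oval γ hαβ (c := c) hh hp hpos.ne'
  have hr : 0 < √(2 * (α * h₀)) := Real.sqrt_pos.2 (by positivity)
  have hω := freq_ne hαβ
  have key := card_le_rootMultiplicity hM0 hr hD (inv_ne_zero hω) (by
    filter_upwards [hD0, lt_mem_nhds hr] with a ha ha0
    have h1 : radialIntegral α β c P Q a = a * M.eval (a ^ 2) :=
      mul_left_cancel₀ ha0.ne' (by rw [hM]; ring)
    rw [ha, h1, div_eq_inv_mul]) fun δ hδ => by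
      obtain ⟨δ', hδ', hfind⟩ := hex δ hδ
      have h1 : ∀ᶠ ε in l, ε ≠ 0 ∧ |ε| < min δ δ' := by
        refine hl ?_
        have h2 : ∀ᶠ ε : ℝ in 𝓝[≠] 0, ε ∈ Metric.ball (0 : ℝ) (min δ δ') :=
          mem_nhdsWithin_of_mem_nhds (Metric.ball_mem_nhds _ (by positivity))
        filter_upwards [h2, self_mem_nhdsWithin] with ε hε hε0
        exact ⟨hε0, by simpa using hε⟩
      have h2 : ∀ᶠ ε in l, ∀ i ∈ S,
          Metric.hausdorffEDist (Γ i ε) (oval α β c h₀) < ENNReal.ofReal δ' :=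
        (Finset.eventually_all S).2 fun i hi =>
          (hlim i hi).eventually_lt_const (ENNReal.ofReal_pos.2 hδ')
      obtain ⟨ε, ⟨hε0, hε⟩, h2, h3, h4⟩ := (h1.and (h2.and hΓ)).exists
      have h5 : ∀ i ∈ S, ∃ a, |a - √(2 * (α * h₀))| < δ ∧ D (a, ε) = 0 ∧ Γ i ε = Z ε a :=
        fun i hi => hfind ε (Γ i ε) hε0 (hε.trans_le (min_le_right _ _)) (h3 i).1 (h3 i).2
          (h2 i hi)
      choose! a ha using h5
      -- Equal zeros would give equal orbits, because `Γ i ε = Z ε a`.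
      have hinj : Set.InjOn a S := fun i hi j hj hij => by
        by_contra hne
        exact h4 i j hne (by rw [(ha i hi).2.2, (ha j hj).2.2, hij])
      have hcard := Finset.card_image_of_injOn hinj
      refine ⟨ε, hε.trans_le (min_le_left _ _), (S.image a).orderEmbOfFin hcard,
        ((S.image a).orderEmbOfFin hcard).strictMono, fun i => ?_⟩
      obtain ⟨j, hj, hji⟩ := Finset.mem_image.1 ((S.image a).orderEmbOfFin_mem hcard i)
      rw [← hji]
      exact ⟨(ha j hj).1, (ha j hj).2.1⟩
  rwa [Real.sq_sqrt (by positivity)] at key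

/-- The number of limit cycles that bifurcate is bounded by the degree. -/
theorem le_natDegree_of_bifurcate {α β γ c : ℝ} (hαβ : α * β < 0) {m : ℕ} {A B C P Q : Poly}
    (hp : IsPerturbation m A B C P Q) {M : Polynomial ℝ} (hM0 : M ≠ 0)
    (hM : ∀ r : ℝ, r * radialIntegral α β c P Q r = r ^ 2 * M.eval (r ^ 2)) {l : Filter ℝ}
    (hne : l.NeBot) (hl : l ≤ 𝓝[≠] (0 : ℝ)) {N : ℕ}
    (hN : LimitCyclesBifurcate α β γ c A B C l N) : N ≤ M.natDegree := by
  obtain ⟨h, Γ, hh, hΓ, hlim⟩ := hN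
  have hα := alpha_ne hαβ
  have hΓ' : ∀ᶠ ε in l, (∀ i, IsPeriodicOrbit α β γ ε A B C (Γ i ε) ∧
      Γ i ε ⊆ upperHemisphere c) ∧ ∀ i j, i ≠ j → Γ i ε ≠ Γ j ε := by
    filter_upwards [hΓ] with ε hε
    exact ⟨fun i => ⟨(hε.1 i).1.1, (hε.1 i).2⟩, hε.2⟩
  -- Several families may tend to the same oval, so the values 2αhᵢ are compared with the roots of M
  -- as multisets, the multiplicity of each being bounded separately.
  have hle : Multiset.map (fun i => 2 * (α * h i)) (Finset.univ : Finset (Fin N)).val ≤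
      M.roots := by
    classical
    rw [Multiset.le_iff_count]
    intro b
    rw [Multiset.count_map, Polynomial.count_roots]
    change (Finset.univ.filter fun i => b = 2 * (α * h i)).card ≤ _
    rcases Finset.eq_empty_or_nonempty (Finset.univ.filter fun i => b = 2 * (α * h i)) with
      he | ⟨i, hi⟩
    · rw [he]; exact Nat.zero_le _
    · have hb := (Finset.mem_filter.1 hi).2
      rw [hb]
      refine card_le_rootMultiplicity_of_bifurcate hαβ hp hM0 hM hl (hh i).1 _ hΓ' fun j hj => ?_
      have hj' := (Finset.mem_filter.1 hj).2
      have : h j = h i := mul_left_cancel₀ hα (by linarith)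
      rw [← this]
      exact hlim j
  have := Multiset.card_le_card hle
  rw [Multiset.card_map, Finset.card_val, Finset.card_univ, Fintype.card_fin] at this
  exact this.trans M.card_roots'

theorem le_of_bifurcate {α β γ c : ℝ} (hαβ : α * β < 0) {m k : ℕ} (hm : m = 2 * k + 2)
    {A B C P Q : Poly} (hp : IsPerturbation m A B C P Q)
    (hI : ∃ h, 0 < α * h ∧ poincarePontryagin α β c P Q h ≠ 0) {l : Filter ℝ} {N : ℕ}
    (hne : l.NeBot) (hl : l ≤ 𝓝[≠] (0 : ℝ))
    (hN : LimitCyclesBifurcate α β γ c A B C l N) : N ≤ k := by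
  obtain ⟨M, hMk, hM⟩ := exists_polynomial_radialIntegral hm hp α β c
  refine (le_natDegree_of_bifurcate hαβ hp ?_ hM hne hl hN).trans hMk
  rintro rfl
  obtain ⟨h, hh, hI⟩ := hI
  refine hI ?_
  rw [poincarePontryagin_eq_radialIntegral hαβ c P Q hh, hM]
  simp

theorem exists_polynomial_poincarePontryagin {α β : ℝ} (hαβ : α * β < 0) (c : ℝ) {m k : ℕ}
    (hm : m = 2 * k + 2) {A B C P Q : Poly} (hp : IsPerturbation m A B C P Q) :
    ∃ M : Polynomial ℝ, M.natDegree ≤ k ∧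
      ∀ h : ℝ, 0 < α * h → poincarePontryagin α β c P Q h = h * M.eval h := by
  obtain ⟨M, hMk, hM⟩ := exists_polynomial_radialIntegral hm hp α β c
  -- The radial polynomial has the variable r² = 2αh; the prefactor r² supplies h and the constant
  -- 2α.
  refine ⟨Polynomial.C (semiX α β * semiY α * (2 * α)) *
    M.comp (Polynomial.C (2 * α) * Polynomial.X), ?_, fun h hh => ?_⟩
  · refine (Polynomial.natDegree_C_mul_le _ _).trans ?_
    refine Polynomial.natDegree_comp_le.trans ?_
    have : (Polynomial.C (2 * α) * Polynomial.X : Polynomial ℝ).natDegree ≤ 1 :=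
      (Polynomial.natDegree_C_mul_le _ _).trans Polynomial.natDegree_X_le
    nlinarith
  · rw [poincarePontryagin_eq_radialIntegral hαβ c P Q hh, hM, Real.sq_sqrt (by positivity)]
    simp only [Polynomial.eval_mul, Polynomial.eval_C, Polynomial.eval_comp, Polynomial.eval_X,
      mul_assoc]
    ring

/-! ### Radial perturbations: exact periodic orbits and limit cycles. -/

theorem continuous_polarPoint (α β c : ℝ) :
    Continuous fun v : ℝ × ℝ => polarPoint α β c v.1 v.2 := by
  unfold polarPoint
  refine (PiLp.continuous_toLp 2 _).comp (continuous_pi fun i => ?_)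
  fin_cases i <;> simp <;> fun_prop

theorem polarPoint_zero (α β c r s : ℝ) :
    polarPoint α β c r s 0 = semiX α β * (r * Real.cos s) := by simp [polarPoint]

theorem polarPoint_one (α β c r s : ℝ) :
    polarPoint α β c r s 1 = semiY α * (r * Real.sin s) := by simp [polarPoint]

theorem polarPoint_two (α β c r s : ℝ) : polarPoint α β c r s 2 =
    √(c ^ 2 - ((semiX α β * (r * Real.cos s)) ^ 2 + (semiY α * (r * Real.sin s)) ^ 2)) := by
  simp [polarPoint]

/-- Ellipses inside an ellipse of the period annulus stay away from the equator. -/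
theorem exists_margin {α β c h₁ : ℝ} (hαβ : α * β < 0) (h : h₁ ∈ annulus α β c) :
    ∃ d > 0, ∀ r s : ℝ, r ^ 2 ≤ 2 * (α * h₁) →
      d ≤ c ^ 2 - ((semiX α β * (r * Real.cos s)) ^ 2 + (semiY α * (r * Real.sin s)) ^ 2) := by
  obtain ⟨h0, h1, h2⟩ := h
  have hα := alpha_ne hαβ
  have hβ := beta_ne hαβ
  refine ⟨c ^ 2 - max (-2 * h₁ / β) (2 * h₁ / α), sub_pos.2 (max_lt h1 h2), fun r s hr => ?_⟩
  have e1 : semiX α β ^ 2 * (2 * (α * h₁)) = -2 * h₁ / β := by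
    rw [semiX_sq hαβ]; field_simp
  have e2 : semiY α ^ 2 * (2 * (α * h₁)) = 2 * h₁ / α := by
    rw [semiY_sq]; field_simp
  have i1 : semiX α β ^ 2 * r ^ 2 ≤ max (-2 * h₁ / β) (2 * h₁ / α) :=
    (mul_le_mul_of_nonneg_left hr (sq_nonneg _)).trans (e1 ▸ le_max_left _ _)
  have i2 : semiY α ^ 2 * r ^ 2 ≤ max (-2 * h₁ / β) (2 * h₁ / α) :=
    (mul_le_mul_of_nonneg_left hr (sq_nonneg _)).trans (e2 ▸ le_max_right _ _)
  have hcs := Real.sin_sq_add_cos_sq s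
  have i3 := mul_le_mul_of_nonneg_right i1 (sq_nonneg (Real.cos s))
  have i4 := mul_le_mul_of_nonneg_right i2 (sq_nonneg (Real.sin s))
  generalize max (-2 * h₁ / β) (2 * h₁ / α) = μ at *
  have : (semiX α β * (r * Real.cos s)) ^ 2 + (semiY α * (r * Real.sin s)) ^ 2 ≤
      μ * (Real.sin s ^ 2 + Real.cos s ^ 2) := by
    ring_nf at i3 i4 ⊢
    linarith
  rw [hcs, mul_one] at this
  linarith

theorem polarPoint_mem_oval {α β c h : ℝ} (hαβ : α * β < 0) (hh : h ∈ annulus α β c) (s : ℝ) :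
    polarPoint α β c √(2 * (α * h)) s ∈ oval α β c h := by
  obtain ⟨d, hd, hm⟩ := exists_margin hαβ hh
  have hsq : √(2 * (α * h)) ^ 2 = 2 * (α * h) := Real.sq_sqrt (by linarith [hh.1])
  have hpos := hd.trans_le (hm √(2 * (α * h)) s hsq.le)
  refine ⟨⟨?_, ?_⟩, ?_⟩
  · rw [polarPoint_zero, polarPoint_one, polarPoint_two, Real.sq_sqrt hpos.le]
    ring
  · rw [polarPoint_two]
    exact Real.sqrt_pos.2 hpos
  · rw [polarPoint_zero, polarPoint_one, H_polar hαβ, hsq]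
    have := alpha_ne hαβ
    field_simp

theorem oval_eq_range {α β c h : ℝ} (hαβ : α * β < 0) (hh : h ∈ annulus α β c) :
    oval α β c h = Set.range fun s => polarPoint α β c √(2 * (α * h)) s := by
  apply Set.Subset.antisymm
  · intro p hp
    have hX := (semiX_pos hαβ).ne'
    have hY := (semiY_pos hαβ).ne'
    obtain ⟨φ, h1, h2⟩ := exists_polar_angle (p 0 / semiX α β) (p 1 / semiY α)
    have hrad : √((p 0 / semiX α β) ^ 2 + (p 1 / semiY α) ^ 2) = √(2 * (α * h)) :=
      radius_eq_of_mem_oval hαβ hp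
    rw [hrad] at h1 h2
    refine ⟨φ, ?_⟩
    have e0 : polarPoint α β c √(2 * (α * h)) φ 0 = p 0 := by
      rw [polarPoint_zero, ← h1]; field_simp
    have e1 : polarPoint α β c √(2 * (α * h)) φ 1 = p 1 := by
      rw [polarPoint_one, ← h2]; field_simp
    have e2 : polarPoint α β c √(2 * (α * h)) φ 2 = p 2 := by
      rw [polarPoint_two, ← polarPoint_zero (c := c), ← polarPoint_one (β := β) (c := c), e0, e1,
        show c ^ 2 - (p 0 ^ 2 + p 1 ^ 2) = p 2 ^ 2 by linarith [hp.1.1], Real.sqrt_sq hp.1.2.le]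
    ext i
    fin_cases i
    · exact e0
    · exact e1
    · exact e2
  · rintro _ ⟨s, rfl⟩
    exact polarPoint_mem_oval hαβ hh s

/-- On the sphere of radius `c` the field `(A, B, C)` is radial with a factor depending on `H`. -/
def IsRadialOnSphere (α β c : ℝ) (A B C : Poly) (σ : ℝ → ℝ) : Prop :=
  ∀ x y z : ℝ, x ^ 2 + y ^ 2 + z ^ 2 = c ^ 2 →
    val A x y z = z * (x * σ ((α * y ^ 2 - β * x ^ 2) / 2)) ∧
    val B x y z = z * (y * σ ((α * y ^ 2 - β * x ^ 2) / 2)) ∧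
    val C x y z = -((x ^ 2 + y ^ 2) * σ ((α * y ^ 2 - β * x ^ 2) / 2))

/-- For radial fields the equation for `H` decouples, and its solutions give solutions of the
perturbed Euler top after a change of time. -/
theorem exists_solution_of_radial {α β γ c ε : ℝ} (hsum : α + β + γ = 0) (hαβ : α * β < 0)
    (hc : 0 < c) {A B C : Poly} {σ : ℝ → ℝ} (hσ : IsRadialOnSphere α β c A B C σ) {h₁ : ℝ}
    (hh₁ : h₁ ∈ annulus α β c) {η : ℝ → ℝ}
    (hη : ∀ s, HasDerivAt η (2 * ε * σ (η s) * η s) s) (hpos : ∀ s, 0 < α * η s)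
    (hle : ∀ s, α * η s ≤ α * h₁) :
    ∃ τ : ℝ ≃o ℝ, IsSolution α β γ ε A B C
        (fun t => polarPoint α β c √(2 * (α * η (τ t))) (freq α β * τ t)) ∧
      ∀ s, τ.symm s = ∫ s in (0 : ℝ)..s,
        (polarPoint α β c √(2 * (α * η s)) (freq α β * s) 2)⁻¹ := by
  have hα := alpha_ne hαβ
  have hω := freq_ne hαβ
  obtain ⟨d, hd, hm⟩ := exists_margin hαβ hh₁
  obtain ⟨r, hr⟩ : ∃ r : ℝ → ℝ, ∀ s, √(2 * (α * η s)) = r s := ⟨_, fun _ => rfl⟩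
  have hrpos : ∀ s, 0 < r s := fun s => by
    rw [← hr]; exact Real.sqrt_pos.2 (by linarith [hpos s])
  have hrsq : ∀ s, r s ^ 2 = 2 * (α * η s) := fun s => by
    rw [← hr]; exact Real.sq_sqrt (by linarith [hpos s])
  have hrd : ∀ s, HasDerivAt r (ε * σ (η s) * r s) s := fun s => by
    have h1 := (((hη s).const_mul α).const_mul 2).sqrt (by linarith [hpos s] : _ ≠ (0 : ℝ))
    rw [funext hr] at h1
    refine h1.congr_deriv ?_
    rw [hr]
    have := (hrpos s).ne'
    have := hrsq s
    field_simp
    linear_combination -(ε * σ (η s)) * this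
  simp only [hr]
  obtain ⟨X, hX⟩ : ∃ X : ℝ → ℝ, ∀ s, semiX α β * (r s * Real.cos (freq α β * s)) = X s :=
    ⟨_, fun _ => rfl⟩
  obtain ⟨Y, hY⟩ : ∃ Y : ℝ → ℝ, ∀ s, semiY α * (r s * Real.sin (freq α β * s)) = Y s :=
    ⟨_, fun _ => rfl⟩
  obtain ⟨Z, hZ⟩ : ∃ Z : ℝ → ℝ, ∀ s, √(c ^ 2 - (X s ^ 2 + Y s ^ 2)) = Z s := ⟨_, fun _ => rfl⟩
  have hlin : ∀ s, HasDerivAt (fun s => freq α β * s) (freq α β) s := fun s => by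
    simpa using (hasDerivAt_id s).const_mul (freq α β)
  -- In the time s the projected motion is the linear centre plus εσ(η) times the position vector.
  have hXd : ∀ s, HasDerivAt X (α * Y s + ε * σ (η s) * X s) s := fun s => by
    rw [← funext hX]
    refine (((hrd s).mul (hlin s).cos).const_mul (semiX α β)).congr_deriv ?_
    rw [← hY]
    linear_combination (-(r s * Real.sin (freq α β * s))) * alpha_mul_semiY hαβ
  have hYd : ∀ s, HasDerivAt Y (β * X s + ε * σ (η s) * Y s) s := fun s => by
    rw [← funext hY]
    refine (((hrd s).mul (hlin s).sin).const_mul (semiY α)).congr_deriv ?_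
    rw [← hX]
    linear_combination (-(r s * Real.cos (freq α β * s))) * beta_mul_semiX hαβ
  have hdZ : ∀ s, d ≤ c ^ 2 - (X s ^ 2 + Y s ^ 2) := fun s => by
    rw [← hX, ← hY]
    exact hm _ _ (by rw [hrsq]; linarith [hle s])
  have hZpos : ∀ s, 0 < Z s := fun s => by
    rw [← hZ]; exact Real.sqrt_pos.2 (hd.trans_le (hdZ s))
  have hZsq : ∀ s, Z s ^ 2 = c ^ 2 - (X s ^ 2 + Y s ^ 2) := fun s => by
    rw [← hZ]; exact Real.sq_sqrt (hd.trans_le (hdZ s)).le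
  have hZd : ∀ s, HasDerivAt Z
      (-(X s * (α * Y s + ε * σ (η s) * X s) + Y s * (β * X s + ε * σ (η s) * Y s)) / Z s) s :=
    fun s => by
      have h1 := ((((hXd s).fun_pow 2).add ((hYd s).fun_pow 2)).const_sub (c ^ 2)).sqrt
        (hd.trans_le (hdZ s)).ne'
      simp only [Pi.add_apply, hZ] at h1
      refine h1.congr_deriv ?_
      have := (hZpos s).ne'
      push_cast
      field_simp
  have hZle : ∀ s, Z s ≤ c := fun s => by
    have := hZsq s
    nlinarith [sq_nonneg (X s), sq_nonneg (Y s), hZpos s]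
  have hZc : Continuous fun s => (Z s)⁻¹ :=
    (continuous_iff_continuousAt.2 fun s => (hZd s).continuousAt).inv₀ fun s => (hZpos s).ne'
  have hH : ∀ s, (α * Y s ^ 2 - β * X s ^ 2) / 2 = η s := fun s => by
    rw [← hX, ← hY, H_polar hαβ, hrsq]
    field_simp
  have hpt0 : ∀ s, polarPoint α β c (r s) (freq α β * s) 0 = X s := fun s => by
    rw [polarPoint_zero, hX]
  have hpt1 : ∀ s, polarPoint α β c (r s) (freq α β * s) 1 = Y s := fun s => by
    rw [polarPoint_one, hY]
  have hpt2 : ∀ s, polarPoint α β c (r s) (freq α β * s) 2 = Z s := fun s => by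
    rw [polarPoint_two, hX, hY, hZ]
  -- The change of time is dt = ds / Z. From 0 < Z ≤ c its speed is at least 1/c, so it is a
  -- bijection of the line and the solution is global.
  obtain ⟨-, τ, hτ1, hτ2, hτd⟩ := exists_inverse_of_le_deriv
    (fun s => intervalIntegral.integral_hasDerivAt_right (hZc.intervalIntegrable 0 s)
      (hZc.stronglyMeasurableAtFilter _ _) hZc.continuousAt)
    (inv_pos.2 hc) (fun s => inv_anti₀ (hZpos s) (hZle s))
  simp only [inv_inv] at hτd
  refine ⟨τ, fun t => ?_, fun s => ?_⟩
  · simp only [hpt0, hpt1, hpt2]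
    obtain ⟨h1, h2, h3⟩ := hσ (X (τ t)) (Y (τ t)) (Z (τ t)) (by rw [hZsq]; ring)
    rw [h1, h2, h3, hH]
    have hZ0 := (hZpos (τ t)).ne'
    refine ⟨((hXd _).comp t (hτd t)).congr_deriv (by ring),
      ((hYd _).comp t (hτd t)).congr_deriv (by ring),
      ((hZd _).comp t (hτd t)).congr_deriv ?_⟩
    field_simp
    -- The third equation follows from staying on the sphere, which the unperturbed flow does
    -- because α + β + γ = 0.
    linear_combination -(X (τ t) * Y (τ t)) * hsum
  · simp only [hpt2]
    rw [OrderIso.symm_apply_eq, hτ2]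

/-- Zeros of the radial factor give periodic orbits. -/
theorem isPeriodicOrbit_oval {α β γ c : ℝ} (ε : ℝ) (hsum : α + β + γ = 0) (hαβ : α * β < 0)
    (hc : 0 < c) {A B C : Poly} {σ : ℝ → ℝ} (hσ : IsRadialOnSphere α β c A B C σ) {h : ℝ}
    (hh : h ∈ annulus α β c) (h0 : σ h = 0) :
    IsPeriodicOrbit α β γ ε A B C (oval α β c h) := by
  have hω := freq_ne hαβ
  obtain ⟨τ, hsol, hτ⟩ := exists_solution_of_radial (ε := ε) hsum hαβ hc hσ hh (η := fun _ => h)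
    (fun s => by simpa [h0] using hasDerivAt_const s h) (fun _ => hh.1) (fun _ => le_rfl)
  obtain ⟨r, hr⟩ : ∃ r, √(2 * (α * h)) = r := ⟨_, rfl⟩
  have hr0 : 0 < r := by rw [← hr]; exact Real.sqrt_pos.2 (by linarith [hh.1])
  simp only [hr] at hsol hτ
  have hper : ∀ s, polarPoint α β c r (freq α β * (s + 2 * Real.pi / freq α β)) =
      polarPoint α β c r (freq α β * s) := fun s => by
    have := polarPoint_add_int_mul α β c r (freq α β * s) 1
    rw [← this]
    congr 1
    push_cast
    field_simp
  have hcont : Continuous fun s => (polarPoint α β c r (freq α β * s) 2)⁻¹ := by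
    refine Continuous.inv₀ ?_ fun s => ?_
    · simp only [polarPoint_two]
      fun_prop
    · rw [← hr]
      exact (polarPoint_mem_oval hαβ hh _).1.2.ne'
  -- Every turn takes the same physical time, the integral of a periodic function over one period.
  have hadd : ∀ s, τ.symm (s + 2 * Real.pi / freq α β) =
      τ.symm s + τ.symm (2 * Real.pi / freq α β) := fun s => by
    have hP : Function.Periodic (fun s => (polarPoint α β c r (freq α β * s) 2)⁻¹)
        (2 * Real.pi / freq α β) := fun s => by simp only [hper]
    have := hP.intervalIntegral_add_eq s 0
    rw [zero_add] at this
    rw [hτ, hτ, hτ, ← this, intervalIntegral.integral_add_adjacent_intervals] <;>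
    exact hcont.intervalIntegrable _ _
  have hx : Function.Periodic (fun t => polarPoint α β c r (freq α β * τ t))
      (τ.symm (2 * Real.pi / freq α β)) := fun t => by
    have : τ (t + τ.symm (2 * Real.pi / freq α β)) = τ t + 2 * Real.pi / freq α β := by
      rw [← OrderIso.eq_symm_apply, hadd, OrderIso.symm_apply_apply]
    simp only [this, hper]
  have hT : τ.symm (2 * Real.pi / freq α β) ≠ 0 := fun h => by
    have h1 : τ.symm 0 = 0 := by rw [hτ]; simp
    have h2 := τ.symm.injective (h.trans h1.symm)
    have : (2 * Real.pi / freq α β) ≠ 0 := div_ne_zero Real.two_pi_pos.ne' hω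
    exact this h2
  refine ⟨_, hsol, ?_, ?_, ?_⟩
  · rcases lt_or_gt_of_ne hT with h | h
    · exact ⟨_, neg_pos.2 h, hx.neg⟩
    · exact ⟨_, h, hx⟩
  · refine ⟨τ.symm 0, τ.symm (Real.pi / freq α β), fun h => ?_⟩
    have h1 := congrArg (fun p : Space => p 0) h
    simp only [OrderIso.apply_symm_apply, polarPoint_zero, mul_zero, Real.cos_zero,
      mul_div_cancel₀ _ hω, Real.cos_pi] at h1
    have := mul_left_cancel₀ (semiX_pos hαβ).ne' h1
    linarith
  · rw [oval_eq_range hαβ hh, hr]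
    ext p
    constructor
    · rintro ⟨s, rfl⟩
      refine ⟨τ.symm (s / freq α β), ?_⟩
      simp only [OrderIso.apply_symm_apply, mul_div_cancel₀ _ hω]
    · rintro ⟨t, rfl⟩
      exact ⟨_, rfl⟩

/-- A zero of the radial factor that attracts another solution of the equation for `H`, in forward
or backward time, gives a limit cycle. -/
theorem isLimitCycle_oval {α β γ c ε : ℝ} (hsum : α + β + γ = 0) (hαβ : α * β < 0)
    (hc : 0 < c) {A B C : Poly} {σ : ℝ → ℝ} (hσ : IsRadialOnSphere α β c A B C σ) {h h₁ : ℝ}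
    (hh : h ∈ annulus α β c) (h0 : σ h = 0) (hh₁ : h₁ ∈ annulus α β c) {η : ℝ → ℝ}
    (hη : ∀ s, HasDerivAt η (2 * ε * σ (η s) * η s) s) (hpos : ∀ s, 0 < α * η s)
    (hle : ∀ s, α * η s ≤ α * h₁) (hne : η 0 ≠ h) {F : Filter ℝ} (hF : F = atTop ∨ F = atBot)
    (hlim : Tendsto η F (𝓝 h)) : IsLimitCycle α β γ ε A B C (oval α β c h) := by
  refine ⟨isPeriodicOrbit_oval ε hsum hαβ hc hσ hh h0, ?_⟩
  have hα := alpha_ne hαβ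
  have hω := freq_ne hαβ
  obtain ⟨τ, hsol, -⟩ := exists_solution_of_radial hsum hαβ hc hσ hh₁ hη hpos hle
  obtain ⟨d, hd, hm⟩ := exists_margin hαβ hh₁
  have hsq : ∀ s, √(2 * (α * η s)) ^ 2 = 2 * (α * η s) :=
    fun s => Real.sq_sqrt (by linarith [hpos s])
  have hmd : ∀ s θ, d ≤ c ^ 2 - ((semiX α β * (√(2 * (α * η s)) * Real.cos θ)) ^ 2 +
      (semiY α * (√(2 * (α * η s)) * Real.sin θ)) ^ 2) := fun s θ =>
    hm _ _ (by rw [hsq]; linarith [hle s])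
  have hH : ∀ s θ, (α * polarPoint α β c √(2 * (α * η s)) θ 1 ^ 2 -
      β * polarPoint α β c √(2 * (α * η s)) θ 0 ^ 2) / 2 = η s := fun s θ => by
    rw [polarPoint_zero, polarPoint_one, H_polar hαβ, hsq]
    field_simp
  obtain ⟨y, hy⟩ : ∃ y : ℝ → Space,
      y = fun t => polarPoint α β c √(2 * (α * η (τ t))) (freq α β * τ t) := ⟨_, rfl⟩
  have hτF : Tendsto τ F F ∧ Tendsto τ.symm F F := by
    rcases hF with rfl | rfl
    · exact ⟨τ.tendsto_atTop, τ.symm.tendsto_atTop⟩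
    · exact ⟨τ.tendsto_atBot, τ.symm.tendsto_atBot⟩
  have hFne : F.NeBot := by rcases hF with rfl | rfl <;> infer_instance
  -- The attracted orbit differs from the oval because H takes the value η 0 ≠ h on it.
  refine ⟨y, hy ▸ hsol, fun he => ?_, ?_⟩
  · have h1 : y (τ.symm 0) ∈ oval α β c h := he ▸ Set.mem_range_self _
    have h2 := h1.2
    rw [hy] at h2
    simp only [OrderIso.apply_symm_apply, hH] at h2
    exact hne h2
  have key : oval α β c h = {p | MapClusterPt p F y} := by
    apply Set.Subset.antisymm
    · rw [oval_eq_range hαβ hh]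
      rintro _ ⟨s, rfl⟩
      -- φ runs to the chosen end of time through moments at which the angle is s modulo 2π; along
      -- them the orbit converges to the given point of the oval.
      obtain ⟨φ, hφ, hφ'⟩ : ∃ φ : ℕ → ℝ, Tendsto φ atTop F ∧
          ∀ n r, polarPoint α β c r (freq α β * φ n) = polarPoint α β c r s := by
        have hbase : Tendsto (fun n : ℕ => 2 * Real.pi / |freq α β| * n) atTop atTop :=
          tendsto_natCast_atTop_atTop.const_mul_atTop (by positivity)
        have hper : ∀ (e : ℝ) (n : ℕ) (r : ℝ), e = 1 ∨ e = -1 → polarPoint α β c r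
            (freq α β * (s / freq α β + e * (2 * Real.pi / |freq α β| * n))) =
              polarPoint α β c r s := by
          intro e n r he
          obtain ⟨k, hk⟩ : ∃ k : ℤ, freq α β * (e / |freq α β|) * n = k := by
            rcases he with rfl | rfl <;> rcases abs_cases (freq α β) with ⟨ha, -⟩ | ⟨ha, -⟩ <;>
              rw [ha]
            · exact ⟨n, by push_cast; field_simp⟩
            · exact ⟨-n, by push_cast; field_simp⟩
            · exact ⟨-n, by push_cast; field_simp⟩
            · exact ⟨n, by push_cast; field_simp⟩
          rw [← polarPoint_add_int_mul α β c r s k, ← hk]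
          congr 1
          field_simp
        rcases hF with rfl | rfl
        · exact ⟨_, tendsto_atTop_add_const_left _ _ (hbase.const_mul_atTop one_pos),
            fun n r => hper 1 n r (Or.inl rfl)⟩
        · exact ⟨_, tendsto_atBot_add_const_left _ _ (hbase.const_mul_atTop_of_neg (by norm_num)),
            fun n r => hper (-1) n r (Or.inr rfl)⟩
      refine MapClusterPt.of_comp (hτF.2.comp hφ) (Tendsto.mapClusterPt ?_)
      have h1 : Tendsto (fun n => √(2 * (α * η (φ n)))) atTop (𝓝 √(2 * (α * h))) :=
        (((hlim.comp hφ).const_mul α).const_mul 2).sqrt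
      have h2 := ((continuous_polarPoint α β c).tendsto (√(2 * (α * h)), s)).comp
        (h1.prodMk_nhds (tendsto_const_nhds (x := s)))
      refine h2.congr fun n => ?_
      simp only [Function.comp_apply, hy, OrderIso.apply_symm_apply, hφ']
    · intro p hp
      -- Conversely, the orbit stays in a closed part of the sphere off the equator, so its cluster
      -- points lie in the open hemisphere, and H tends to h along it.
      have hcl : IsClosed {q : Space | q 0 ^ 2 + q 1 ^ 2 + q 2 ^ 2 = c ^ 2 ∧ √d ≤ q 2} := by
        have h1 : Continuous fun q : Space => q 0 ^ 2 + q 1 ^ 2 + q 2 ^ 2 := by fun_prop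
        have h2 : Continuous fun q : Space => q 2 := by fun_prop
        exact (isClosed_eq h1 continuous_const).inter (isClosed_le continuous_const h2)
      have hmem : p ∈ {q : Space | q 0 ^ 2 + q 1 ^ 2 + q 2 ^ 2 = c ^ 2 ∧ √d ≤ q 2} := by
        refine hcl.mem_of_mapClusterPt hp (Eventually.of_forall fun t => ?_)
        rw [hy]
        have h1 := hmd (τ t) (freq α β * τ t)
        refine ⟨?_, ?_⟩
        · rw [polarPoint_zero, polarPoint_one, polarPoint_two, Real.sq_sqrt (hd.le.trans h1)]
          ring
        · rw [polarPoint_two]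
          exact Real.sqrt_le_sqrt h1
      refine ⟨⟨hmem.1, (Real.sqrt_pos.2 hd).trans_le hmem.2⟩, ?_⟩
      have hHc : Continuous fun q : Space => (α * q 1 ^ 2 - β * q 0 ^ 2) / 2 := by
        fun_prop
      have h1 := hp.continuousAt_comp hHc.continuousAt
      have h2 : (fun q : Space => (α * q 1 ^ 2 - β * q 0 ^ 2) / 2) ∘ y = η ∘ τ := by
        ext t
        rw [hy]
        exact hH _ _
      rw [h2] at h1
      have h3 : Tendsto (η ∘ τ) F (𝓝 h) := hlim.comp hτF.1
      have h4 : (𝓝 ((α * p 1 ^ 2 - β * p 0 ^ 2) / 2) ⊓ 𝓝 h).NeBot :=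
        NeBot.mono h1 (inf_le_inf_left _ h3)
      exact eq_of_nhds_neBot h4
  rcases hF with rfl | rfl
  · exact Or.inl key
  · exact Or.inr key

/-! ### Heteroclinic solutions of the scalar equation. -/

/-- The function `1 / √(1 + e^{κ s})`, a solution of `2 u' = κ u (u² - 1)`. -/
def heteroclinic (κ s : ℝ) : ℝ := (√(1 + Real.exp (κ * s)))⁻¹

theorem heteroclinic_pos (κ s : ℝ) : 0 < heteroclinic κ s := by
  unfold heteroclinic
  positivity

theorem heteroclinic_lt_one (κ s : ℝ) : heteroclinic κ s < 1 := by
  refine inv_lt_one_of_one_lt₀ ?_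
  rw [Real.lt_sqrt zero_le_one]
  linarith [Real.exp_pos (κ * s)]

theorem hasDerivAt_heteroclinic (κ s : ℝ) : HasDerivAt (heteroclinic κ)
    (κ / 2 * heteroclinic κ s * (heteroclinic κ s ^ 2 - 1)) s := by
  have h0 : 0 < 1 + Real.exp (κ * s) := by positivity
  have h1 : HasDerivAt (fun s => κ * s) κ s := by simpa using (hasDerivAt_id s).const_mul κ
  have h2 := ((h1.exp.const_add 1).sqrt h0.ne').fun_inv (Real.sqrt_pos.2 h0).ne'
  refine h2.congr_deriv ?_
  have h3 := Real.sq_sqrt h0.le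
  have h4 := (Real.sqrt_pos.2 h0).ne'
  unfold heteroclinic
  generalize √(1 + Real.exp (κ * s)) = q at *
  have h5 : Real.exp (κ * s) = q ^ 2 - 1 := by linarith
  rw [h5]
  field_simp
  ring

/-- The sign of κ, and so that of ε, only decides which equilibrium is reached at which end of time.
A limit cycle may be an ω- or an α-limit set, so both signs serve. -/
theorem exists_tendsto_heteroclinic {κ : ℝ} (hκ : κ ≠ 0) :
    (∃ F : Filter ℝ, (F = atTop ∨ F = atBot) ∧ Tendsto (heteroclinic κ) F (𝓝 1)) ∧
      ∃ F : Filter ℝ, (F = atTop ∨ F = atBot) ∧ Tendsto (heteroclinic κ) F (𝓝 0) := by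
  have h1 : ∀ F : Filter ℝ, Tendsto (fun s => κ * s) F atBot →
      Tendsto (heteroclinic κ) F (𝓝 1) := fun F hF => by
    have := (((Real.tendsto_exp_atBot.comp hF).const_add 1).sqrt).inv₀ (by simp)
    rw [add_zero, Real.sqrt_one, inv_one] at this
    exact this
  have h2 : ∀ F : Filter ℝ, Tendsto (fun s => κ * s) F atTop →
      Tendsto (heteroclinic κ) F (𝓝 0) := fun F hF => by
    have := tendsto_atTop_add_const_left _ (1 : ℝ) (Real.tendsto_exp_atTop.comp hF)
    exact (Real.tendsto_sqrt_atTop.comp this).inv_tendsto_atTop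
  rcases lt_or_gt_of_ne hκ with h | h
  · exact ⟨⟨atTop, Or.inl rfl, h1 _ (tendsto_id.const_mul_atTop_of_neg h)⟩,
      ⟨atBot, Or.inr rfl, h2 _ (tendsto_id.const_mul_atBot_of_neg h)⟩⟩
  · exact ⟨⟨atBot, Or.inr rfl, h1 _ (tendsto_id.const_mul_atBot h)⟩,
      ⟨atTop, Or.inl rfl, h2 _ (tendsto_id.const_mul_atTop h)⟩⟩

/-! ### Explicit perturbations of degrees 4 and 6. -/

open MvPolynomial in
/-- The radial perturbation field with factor `S(x₁, x₂, x₃²)`. -/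
theorem isPerturbation_radial {d : ℕ} {S : Poly}
    (hS : (aeval ![X 0, X 1, (X 2 : Poly) ^ 2] S).IsHomogeneous d) :
    IsPerturbation (d + 2)
      (X 2 * (X 0 * aeval ![X 0, X 1, (X 2 : Poly) ^ 2] S))
      (X 2 * (X 1 * aeval ![X 0, X 1, (X 2 : Poly) ^ 2] S))
      (-((X 0 ^ 2 + X 1 ^ 2) * aeval ![X 0, X 1, (X 2 : Poly) ^ 2] S)) (X 0 * S) (X 1 * S) where
  homA := by
    convert (isHomogeneous_X ℝ (2 : Fin 3)).mul ((isHomogeneous_X ℝ (0 : Fin 3)).mul hS) using 1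
    ring
  homB := by
    convert (isHomogeneous_X ℝ (2 : Fin 3)).mul ((isHomogeneous_X ℝ (1 : Fin 3)).mul hS) using 1
    ring
  homC := by
    have := ((isHomogeneous_X_pow (R := ℝ) (0 : Fin 3) 2).add
      (isHomogeneous_X_pow (R := ℝ) (1 : Fin 3) 2)).mul hS
    rw [add_comm d 2]
    exact this.neg
  tangent := by ring
  formA := by simp
  formB := by simp

open MvPolynomial in
theorem isRadialOnSphere_radial {α β c : ℝ} {S : Poly} {σ : ℝ → ℝ}
    (hσ : ∀ x y, val S x y (c ^ 2 - (x ^ 2 + y ^ 2)) = σ ((α * y ^ 2 - β * x ^ 2) / 2)) :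
    IsRadialOnSphere α β c
      (X 2 * (X 0 * aeval ![X 0, X 1, (X 2 : Poly) ^ 2] S))
      (X 2 * (X 1 * aeval ![X 0, X 1, (X 2 : Poly) ^ 2] S))
      (-((X 0 ^ 2 + X 1 ^ 2) * aeval ![X 0, X 1, (X 2 : Poly) ^ 2] S)) σ := by
  intro x y z h
  have hz : z ^ 2 = c ^ 2 - (x ^ 2 + y ^ 2) := by linarith
  have hS := eval_aeval_sq S x y z
  rw [hz, hσ] at hS
  simp only [val, map_mul, map_neg, map_add, map_pow, eval_X, hS, Matrix.cons_val, true_and]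

/-- The integrand is constant in θ because the factor depends on H alone. So I is not identically
zero as soon as σ is nonzero at some admissible h. -/
theorem poincarePontryagin_radial {α β c : ℝ} (hαβ : α * β < 0) {S : Poly} {σ : ℝ → ℝ}
    (hσ : ∀ x y, val S x y (c ^ 2 - (x ^ 2 + y ^ 2)) = σ ((α * y ^ 2 - β * x ^ 2) / 2))
    {h : ℝ} (hh : 0 < α * h) :
    poincarePontryagin α β c (MvPolynomial.X 0 * S) (MvPolynomial.X 1 * S) h =
      semiX α β * semiY α * (2 * (α * h)) * (2 * Real.pi) * σ h := by
  have hα := alpha_ne hαβ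
  have hX := (semiX_pos hαβ).ne'
  have hY := (semiY_pos hαβ).ne'
  have hsq : √(2 * (α * h)) ^ 2 = 2 * (α * h) := Real.sq_sqrt (by positivity)
  have hv : ∀ (i : Fin 3) x y z, val (MvPolynomial.X i * S) x y z = ![x, y, z] i * val S x y z := by
    intro i x y z
    simp [val]
  rw [poincarePontryagin_eq_radialIntegral hαβ c _ _ hh, radialIntegral_eq]
  have : ∀ θ, radialPart α β c (MvPolynomial.X 0 * S) (MvPolynomial.X 1 * S) √(2 * (α * h)) θ =
      √(2 * (α * h)) * σ h := fun θ => by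
    have e : √(2 * (α * h)) ^ 2 / (2 * α) = h := by rw [hsq]; field_simp
    unfold radialPart
    rw [hv, hv, hσ, H_polar hαβ, e]
    have hcs := Real.sin_sq_add_cos_sq θ
    simp only [Matrix.cons_val]
    generalize √(2 * (α * h)) = r
    field_simp
    linear_combination r * σ h * hcs
  simp only [this, intervalIntegral.integral_const, smul_eq_mul]
  linear_combination semiX α β * semiY α * (2 * Real.pi) * σ h * hsq

open MvPolynomial in
/-- The polynomial equal to `H - a` on the sphere of radius `c`, as a polynomial in
`x₁, x₂, x₃²`. -/
def levelPoly (α β c a : ℝ) : Poly :=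
  MvPolynomial.C (α / 2) * X 1 ^ 2 - MvPolynomial.C (β / 2) * X 0 ^ 2 -
    -- X 2 stands for x₃², so the bracket equals c² on the sphere; this writes the constant a as a
    -- quadratic form.
    MvPolynomial.C (a / c ^ 2) * (X 0 ^ 2 + X 1 ^ 2 + X 2)

theorem val_levelPoly {c : ℝ} (hc : 0 < c) (α β a x y : ℝ) :
    val (levelPoly α β c a) x y (c ^ 2 - (x ^ 2 + y ^ 2)) = (α * y ^ 2 - β * x ^ 2) / 2 - a := by
  simp [val, levelPoly]
  field_simp

open MvPolynomial in
theorem isHomogeneous_levelPoly (α β c a : ℝ) :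
    (aeval ![X 0, X 1, (X 2 : Poly) ^ 2] (levelPoly α β c a)).IsHomogeneous 2 := by
  have hX := fun i : Fin 3 => isHomogeneous_X_pow (R := ℝ) i 2
  have : aeval ![X 0, X 1, (X 2 : Poly) ^ 2] (levelPoly α β c a) =
      MvPolynomial.C (α / 2) * X 1 ^ 2 - MvPolynomial.C (β / 2) * X 0 ^ 2 -
        MvPolynomial.C (a / c ^ 2) * (X 0 ^ 2 + X 1 ^ 2 + X 2 ^ 2) := by
    simp [levelPoly, algebraMap_eq]
  rw [this]
  exact (((hX 1).C_mul _).sub ((hX 0).C_mul _)).sub ((((hX 0).add (hX 1)).add (hX 2)).C_mul _)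

theorem val_mul (S T : Poly) (x y z : ℝ) : val (S * T) x y z = val S x y z * val T x y z := by
  simp [val]

/-- The conditions on h are linear inequalities, so every sufficiently small positive multiple of α
qualifies. The pair a, 2a gives two nested ovals. -/
theorem exists_mem_annulus {α β c : ℝ} (hαβ : α * β < 0) (hc : 0 < c) :
    ∃ a, a ∈ annulus α β c ∧ 2 * a ∈ annulus α β c := by
  have hα := alpha_ne hαβ
  have hβ := beta_ne hαβ
  have hκ : 0 < -α / β := by
    have : -α / β = -(α * β) / β ^ 2 := by field_simp
    rw [this]
    have : 0 < -(α * β) := by linarith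
    positivity
  obtain ⟨κ, hκ'⟩ : ∃ κ, -α / β = κ := ⟨_, rfl⟩
  rw [hκ'] at hκ
  obtain ⟨s, hs, h1, h2⟩ : ∃ s > 0, 4 * κ * s < c ^ 2 ∧ 4 * s < c ^ 2 := by
    refine ⟨c ^ 2 / (8 * (1 + κ)), by positivity, ?_, ?_⟩
    · rw [mul_div_assoc', div_lt_iff₀ (by positivity)]
      nlinarith [sq_pos_of_pos hc, mul_pos (sq_pos_of_pos hc) hκ]
    · rw [mul_div_assoc', div_lt_iff₀ (by positivity)]
      nlinarith [sq_pos_of_pos hc, mul_pos (sq_pos_of_pos hc) hκ]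
  have key : ∀ t, 0 < t → t ≤ 2 * s → α * t ∈ annulus α β c := fun t ht hts => by
    refine ⟨?_, ?_, ?_⟩
    · rw [← mul_assoc]
      have : 0 < α * α := mul_self_pos.2 hα
      positivity
    · have : -2 * (α * t) / β = 2 * t * κ := by rw [← hκ']; field_simp
      rw [this]
      nlinarith
    · have : 2 * (α * t) / α = 2 * t := by field_simp
      rw [this]
      linarith
  refine ⟨α * s, key s hs (by linarith), ?_⟩
  rw [← mul_left_comm]
  exact key (2 * s) (by linarith) le_rfl

/-- Constant families of limit cycles. -/
theorem limitCyclesBifurcate_const {α β γ c : ℝ} (hαβ : α * β < 0) {A B C : Poly} {N : ℕ}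
    {h : Fin N → ℝ} (hh : ∀ i, h i ∈ annulus α β c) (hinj : Function.Injective h)
    (hcyc : ∀ ε ≠ 0, ∀ i, IsLimitCycle α β γ ε A B C (oval α β c (h i))) :
    LimitCyclesBifurcate α β γ c A B C (𝓝[≠] (0 : ℝ)) N := by
  refine ⟨h, fun i _ => oval α β c (h i), hh, ?_, fun i => ?_⟩
  · filter_upwards [self_mem_nhdsWithin] with ε hε
    refine ⟨fun i => ⟨hcyc ε hε i, fun p hp => hp.1⟩, fun i j hij he => hij (hinj ?_)⟩
    have h1 := polarPoint_mem_oval hαβ (hh i) 0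
    have h2 := h1.2
    rw [he] at h1
    rw [← h2, ← h1.2]
  · simp

/-- With σ(h) = h - a the scalar equation is η' = 2ε(η - a)η. Setting η = au² reduces it to the
heteroclinic equation with κ = 2εa, whose solution tends to u = 1 at one end. -/
theorem exists_one_limitCycle {α β γ c : ℝ} (hsum : α + β + γ = 0) (hαβ : α * β < 0)
    (hc : 0 < c) : ∃ A B C P Q : Poly, IsPerturbation 4 A B C P Q ∧
      (∃ h : ℝ, 0 < α * h ∧ poincarePontryagin α β c P Q h ≠ 0) ∧
      LimitCyclesBifurcate α β γ c A B C (𝓝[≠] (0 : ℝ)) 1 := by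
  obtain ⟨a, ha, ha2⟩ := exists_mem_annulus hαβ hc
  have ha0 : a ≠ 0 := by rintro rfl; simpa using ha.1
  have hσ : ∀ x y, val (levelPoly α β c a) x y (c ^ 2 - (x ^ 2 + y ^ 2)) =
      (fun h => h - a) ((α * y ^ 2 - β * x ^ 2) / 2) := fun x y => val_levelPoly hc α β a x y
  refine ⟨_, _, _, _, _, isPerturbation_radial (isHomogeneous_levelPoly α β c a),
    ⟨2 * a, ha2.1, ?_⟩, limitCyclesBifurcate_const hαβ (h := fun _ => a) (fun _ => ha)
      (Function.injective_of_subsingleton _) fun ε hε _ => ?_⟩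
  · rw [poincarePontryagin_radial hαβ (σ := fun h => h - a) hσ ha2.1]
    have := (semiX_pos hαβ).ne'
    have := (semiY_pos hαβ).ne'
    have := alpha_ne hαβ
    have := Real.pi_pos
    have : 2 * a - a ≠ 0 := by rwa [two_mul, add_sub_cancel_right]
    positivity
  · obtain ⟨⟨F, hF, hlim⟩, -⟩ := exists_tendsto_heteroclinic (κ := 2 * ε * a) (by positivity)
    have hu := heteroclinic_pos (2 * ε * a)
    have hu1 := heteroclinic_lt_one (2 * ε * a)
    refine isLimitCycle_oval hsum hαβ hc (isRadialOnSphere_radial (σ := fun h => h - a) hσ) ha (sub_self a) ha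
      (η := fun s => a * heteroclinic (2 * ε * a) s ^ 2) (fun s => ?_) (fun s => ?_) (fun s => ?_)
      ?_ hF ?_
    · refine (((hasDerivAt_heteroclinic (2 * ε * a) s).fun_pow 2).const_mul a).congr_deriv ?_
      push_cast
      ring
    · rw [← mul_assoc]
      exact mul_pos ha.1 (pow_pos (hu s) 2)
    · rw [← mul_assoc]
      exact mul_le_of_le_one_right ha.1.le (pow_le_one₀ (hu s).le (hu1 s).le)
    · intro h
      have h1 : heteroclinic (2 * ε * a) 0 ^ 2 = 1 := mul_left_cancel₀ ha0 (by rw [h, mul_one])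
      exact (pow_lt_one₀ (hu 0).le (hu1 0) two_ne_zero).ne h1
    · simpa using (hlim.pow 2).const_mul a

/-- With σ(h) = (h - a)(h - 2a) and η = a(1 + u), the scalar equation becomes the heteroclinic one
with κ = 4εa². A single solution joins the ovals a and 2a, and its two ends make both of them limit
cycles. -/
theorem exists_two_limitCycles {α β γ c : ℝ} (hsum : α + β + γ = 0) (hαβ : α * β < 0)
    (hc : 0 < c) : ∃ A B C P Q : Poly, IsPerturbation 6 A B C P Q ∧
      (∃ h : ℝ, 0 < α * h ∧ poincarePontryagin α β c P Q h ≠ 0) ∧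
      LimitCyclesBifurcate α β γ c A B C (𝓝[≠] (0 : ℝ)) 2 := by
  obtain ⟨a, ha, ha2⟩ := exists_mem_annulus hαβ hc
  have ha0 : a ≠ 0 := by rintro rfl; simpa using ha.1
  have hσ : ∀ x y, val (levelPoly α β c a * levelPoly α β c (2 * a)) x y
      (c ^ 2 - (x ^ 2 + y ^ 2)) =
      (fun h => (h - a) * (h - 2 * a)) ((α * y ^ 2 - β * x ^ 2) / 2) := fun x y => by
    rw [val_mul, val_levelPoly hc, val_levelPoly hc]
  have hhom := (isHomogeneous_levelPoly α β c a).mul (isHomogeneous_levelPoly α β c (2 * a))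
  rw [← map_mul] at hhom
  have hpos3 : 0 < α * (3 * a) := by
    have := ha.1
    rw [← mul_left_comm]
    positivity
  refine ⟨_, _, _, _, _, isPerturbation_radial hhom, ⟨3 * a, hpos3, ?_⟩,
    limitCyclesBifurcate_const hαβ (h := ![a, 2 * a]) (fun i => ?_) ?_ fun ε hε i => ?_⟩
  · rw [poincarePontryagin_radial hαβ (σ := fun h => (h - a) * (h - 2 * a)) hσ hpos3]
    have := (semiX_pos hαβ).ne'
    have := (semiY_pos hαβ).ne'
    have := alpha_ne hαβ
    have := Real.pi_pos
    rw [show (3 * a - a) * (3 * a - 2 * a) = 2 * a ^ 2 by ring]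
    positivity
  · fin_cases i
    · exact ha
    · exact ha2
  · intro i j h
    have h2 : a ≠ 2 * a := fun h => ha0 (by linarith)
    fin_cases i <;> fin_cases j <;> simp_all
  · have hκ : 4 * ε * a ^ 2 ≠ 0 := by positivity
    obtain ⟨⟨F, hF, hlim⟩, ⟨F', hF', hlim'⟩⟩ := exists_tendsto_heteroclinic hκ
    have hu := heteroclinic_pos (4 * ε * a ^ 2)
    have hu1 := heteroclinic_lt_one (4 * ε * a ^ 2)
    have hη : ∀ s, HasDerivAt (fun s => a * (1 + heteroclinic (4 * ε * a ^ 2) s))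
        (2 * ε * ((fun h => (h - a) * (h - 2 * a)) (a * (1 + heteroclinic (4 * ε * a ^ 2) s))) *
          (a * (1 + heteroclinic (4 * ε * a ^ 2) s))) s := fun s => by
      refine (((hasDerivAt_heteroclinic (4 * ε * a ^ 2) s).const_add 1).const_mul a).congr_deriv ?_
      ring
    have hpos : ∀ s, 0 < α * (a * (1 + heteroclinic (4 * ε * a ^ 2) s)) := fun s => by
      rw [← mul_assoc]
      exact mul_pos ha.1 (by linarith [hu s])
    have hle : ∀ s, α * (a * (1 + heteroclinic (4 * ε * a ^ 2) s)) ≤ α * (2 * a) := fun s => by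
      have := mul_le_mul_of_nonneg_left (hu1 s).le ha.1.le
      linarith
    have hrad := isRadialOnSphere_radial (σ := fun h => (h - a) * (h - 2 * a)) hσ
    fin_cases i
    · refine isLimitCycle_oval hsum hαβ hc hrad ha (by simp) ha2 hη hpos
        hle ?_ hF' (by simpa using (hlim'.const_add 1).const_mul a)
      intro h
      have h1 : 1 + heteroclinic (4 * ε * a ^ 2) 0 = 1 := mul_left_cancel₀ ha0 (Eq.trans h (mul_one a).symm)
      linarith [hu 0]
    · refine isLimitCycle_oval hsum hαβ hc hrad ha2 (by simp) ha2 hη hpos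
        hle ?_ hF ?_
      · intro h
        have h1 : 1 + heteroclinic (4 * ε * a ^ 2) 0 = 2 :=
          mul_left_cancel₀ ha0 (Eq.trans h (mul_comm 2 a))
        linarith [hu1 0]
      · have := (hlim.const_add 1).const_mul a
        rwa [show a * (1 + 1) = 2 * a by ring] at this

end EulerTop

end

theorem corollary1 (α β γ c : ℝ) (hsum : α + β + γ = 0) (hαβ : α * β < 0) (hc : 0 < c) :
    -- the bound `n - 1` with `n = m - 1` is not attained
    (∀ m n : ℕ, 3 ≤ m → n = m - 1 → ∀ A B C P Q : EulerTop.Poly,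
      EulerTop.IsPerturbation m A B C P Q →
        P.totalDegree ≤ n ∧ Q.totalDegree ≤ n ∧
        ((∃ h : ℝ, 0 < α * h ∧ EulerTop.poincarePontryagin α β c P Q h ≠ 0) →
          ∀ (l : Filter ℝ) (N : ℕ), l.NeBot → l ≤ 𝓝[≠] (0 : ℝ) →
            EulerTop.LimitCyclesBifurcate α β γ c A B C l N → N < n - 1)) ∧
    -- (i)
    (∀ m : ℕ, m = 3 ∨ m = 5 → ∀ A B C P Q : EulerTop.Poly,
      EulerTop.IsPerturbation m A B C P Q →
        ∀ h : ℝ, 0 < α * h → EulerTop.poincarePontryagin α β c P Q h = 0) ∧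
    -- (ii)
    (∀ m k : ℕ, (m = 4 ∧ k = 1) ∨ (m = 6 ∧ k = 2) →
      (∀ A B C P Q : EulerTop.Poly, EulerTop.IsPerturbation m A B C P Q →
        (∃ M : Polynomial ℝ, M.natDegree ≤ k ∧
          ∀ h : ℝ, 0 < α * h → EulerTop.poincarePontryagin α β c P Q h = h * M.eval h) ∧
        ((∃ h : ℝ, 0 < α * h ∧ EulerTop.poincarePontryagin α β c P Q h ≠ 0) →
          ∀ (l : Filter ℝ) (N : ℕ), l.NeBot → l ≤ 𝓝[≠] (0 : ℝ) →
            EulerTop.LimitCyclesBifurcate α β γ c A B C l N → N ≤ k)) ∧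
      (∃ A B C P Q : EulerTop.Poly, EulerTop.IsPerturbation m A B C P Q ∧
        (∃ h : ℝ, 0 < α * h ∧ EulerTop.poincarePontryagin α β c P Q h ≠ 0) ∧
        EulerTop.LimitCyclesBifurcate α β γ c A B C (𝓝[≠] (0 : ℝ)) k)) ∧
    -- (iii)
    (∀ A B C P Q : EulerTop.Poly, EulerTop.IsPerturbation 7 A B C P Q →
      (∃ h : ℝ, 0 < α * h ∧ EulerTop.poincarePontryagin α β c P Q h ≠ 0) →
        (α ≠ β → ∀ h : ℝ, (0 < α * h ∧ EulerTop.poincarePontryagin α β c P Q h = 0) ↔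
          h = α * β * c ^ 2 / (β - α)) ∧
        (α = β → ∀ h : ℝ, 0 < α * h → EulerTop.poincarePontryagin α β c P Q h ≠ 0)) := by
  refine ⟨fun m n hm hn A B C P Q hp => ?_, fun m hm A B C P Q hp h _ => ?_, fun m k hmk => ?_,
    fun A B C P Q hp ⟨h, _, hI⟩ => ?_⟩
  · have hm' : m = n + 1 := by omega
    subst hm'
    refine ⟨EulerTop.totalDegree_le_of_weight fun d hd =>
        EulerTop.weight_eq_of_isHomogeneous hp.homA hp.formA hd,
      EulerTop.totalDegree_le_of_weight fun d hd =>
        EulerTop.weight_eq_of_isHomogeneous hp.homB hp.formB hd, fun hI l N hl hl0 hN => ?_⟩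
    rcases Nat.even_or_odd n with ⟨k, hk⟩ | ⟨k, hk⟩
    · obtain ⟨h, _, hI⟩ := hI
      exact absurd (EulerTop.poincarePontryagin_eq_zero (k := k) (by omega) hp α β c h) hI
    -- Here m = 2k + 2 and n - 1 = 2k, and m ≥ 3 forces k ≥ 1, so N ≤ k < n - 1.
    · have := EulerTop.le_of_bifurcate hαβ (k := k) (by omega) hp hI hl hl0 hN
      omega
  · rcases hm with rfl | rfl
    · exact EulerTop.poincarePontryagin_eq_zero (k := 1) rfl hp α β c h
    · exact EulerTop.poincarePontryagin_eq_zero (k := 2) rfl hp α β c h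
  · have hm : m = 2 * k + 2 := by omega
    refine ⟨fun A B C P Q hp => ⟨EulerTop.exists_polynomial_poincarePontryagin hαβ c hm hp,
      fun hI l N hl hl0 hN => EulerTop.le_of_bifurcate hαβ hm hp hI hl hl0 hN⟩, ?_⟩
    rcases hmk with ⟨rfl, rfl⟩ | ⟨rfl, rfl⟩
    · exact EulerTop.exists_one_limitCycle hsum hαβ hc
    · exact EulerTop.exists_two_limitCycles hsum hαβ hc
  -- Since 7 is odd, I vanishes identically and the assumption of (iii) is contradictory.
  · exact absurd (EulerTop.poincarePontryagin_eq_zero (k := 3) rfl hp α β c h) hI
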